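/- Let $\mathbf{S}_{\min}$ be the set $\{(\infty,\infty)\}\cup(\mathbb{N}\times\{\infty\})\cup\mathbb{N}^2$ with the topology generated by the sets $\{(a,b)\}$, $\{(a,\infty)\}\cup\{(a,j)\mid j\ge b\}$ and $\{(\infty,\infty)\}\cup\{(i,\infty)\mid i\ge a\}\cup\{(i,j)\mid i\ge a,\ j\ge \ell(i)\}$ for $a,b\in\mathbb{N}$, $\ell\in\mathbb{N}^{\mathbb{N}}$, represented by the partial surjection $\delta:\subseteq\mathbb{N}^{\mathbb{N}}\to\mathbf{S}_{\min}$ with domain $\{i0^\omega,\ i0^j1^\omega \mid i,j\in\mathbb{N}\}$ given by $$\delta(00^\omega)=(\infty,\infty),\qquad \delta(00^a1^\omega)=\delta((a+1)0^\omega)=(a,\infty),\qquad \delta((a+1)0^b1^\omega)=(a,b).$$ For a represented space $\mathbf{X}$, let $\mathcal{O}(\mathbf{X})$ be the represented space of its open subsets, a name of $U$ being a name of the continuous characteristic function of $U$ from $\mathbf{X}$ to Sierpiński space, and let $\mathcal{V}(\mathbf{X})$ be the represented space of its closed subsets, a name of $A$ being a name of $\{U\in\mathcal{O}(\mathbf{X})\mid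 U\cap A\neq\emptyset\}$ as an element of $\mathcal{O}(\mathcal{O}(\mathbf{X}))$. Overt choice $\mathrm{VC}_{\mathbf{X}}:\subseteq\mathcal{V}(\mathbf{X})\rightrightarrows\mathbf{X}$ is the multivalued function whose domain consists of the non-empty $A$ and whose admissible values at $A$ are the elements of $A$. Let $\mathrm{LPO}:\mathbb{N}^{\mathbb{N}}\to\{0,1\}$ be given by $\mathrm{LPO}(r)=1$ if and only if $r(k)=0$ for some $k\in\mathbb{N}$. For multivalued functions $f,g$ between represented spaces, $f\le_{\mathrm{W}}g$ means that there are computable $H,K:\subseteq\mathbb{N}^{\mathbb{N}}\to\mathbb{N}^{\mathbb{N}}$ such that $p\mapsto K(\langle p,G(H(p))\rangle)$ is a realizer of $f$ for every realizer $G$ of $g$; and $f\equiv_{\mathrm{W}}g$ means $f\le_{\mathrm{W}}g$ and $g\le_{\mathrm{W}}f$. Theorem. $\mathrm{VC}_{\mathbf{S}_{\min}}\equiv_{\mathrm{W}}\mathrm{LPO}$. -/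

import Mathlib

namespace OvertChoice

/-! ### Computability and continuity on Baire space -/

/-- Baire space; it carries the product topology of the discrete spaces `ℕ`. -/
abbrev Baire : Type := ℕ → ℕ

/-- The finite word `x 0, …, x (m - 1)`. -/
def initSeg (x : Baire) (m : ℕ) : List ℕ := (List.range m).map x

/-- The entry of `p` at (the code of) the pair of an output position `n` and a finite word `w`. -/
def query (p : Baire) (n : ℕ) (w : List ℕ) : ℕ := p (Encodable.encode (n, w))

/-- The partial continuous function with (Kleene) associate `p`, that is, the application of
Kleene's second algebra.  To obtain entry `n` of the value at `x`, longer and longer initial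
segments `w` of `x` are fed to `p`, until `query p n w` has the form `k + 1`; then the entry is `k`.
The value at `x` is defined if and only if all of its entries are. -/
def kleene (p : Baire) : Baire →. Baire := fun x =>
  ⟨∀ n, ∃ m, query p n (initSeg x m) ≠ 0,
   fun h n => query p n (initSeg x (Nat.find (h n))) - 1⟩

/-- A partial function on Baire space is computable if there is a computable procedure that,
for each `x` in its domain, determines every entry of the value from a finite initial segment
of `x`, i.e. if it is a restriction of a partial function with a computable associate. -/
def ComputableFun (F : Baire →. Baire) : Prop :=
  ∃ p : Baire, Computable p ∧ ∀ x y, y ∈ F x → y ∈ kleene p x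

/-- Continuity of a partial function on Baire space, on its domain with the subspace topology. -/
def ContinuousFun (F : Baire →. Baire) : Prop := Continuous F.asSubtype

/-- The pairing `⟨p, q⟩ = p 0, q 0, p 1, q 1, …`. -/
def pair (p q : Baire) : Baire := fun n => if n % 2 = 0 then p (n / 2) else q (n / 2)

theorem mem_kleene {p x y : Baire} :
    y ∈ kleene p x ↔ ∀ n, ∃ m, query p n (initSeg x m) = y n + 1 ∧
      ∀ m' < m, query p n (initSeg x m') = 0 := by
  constructor
  · rintro ⟨h, rfl⟩ n
    refine ⟨Nat.find (h n), ?_, fun m' hm' => ?_⟩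
    · have := Nat.find_spec (h n)
      simp only [kleene]
      omega
    · have := Nat.find_min (h n) hm'
      simpa using this
  · intro h
    have hd : ∀ n, ∃ m, query p n (initSeg x m) ≠ 0 := fun n => by
      obtain ⟨m, hm, -⟩ := h n
      exact ⟨m, by omega⟩
    refine ⟨hd, funext fun n => ?_⟩
    obtain ⟨m, hm, hlt⟩ := h n
    have hf : Nat.find (hd n) = m := by
      rw [Nat.find_eq_iff]
      exact ⟨by omega, fun k hk => by simpa using hlt k hk⟩
    simp only [kleene, hf, hm]
    omega

theorem initSeg_eq_iff {x y : Baire} {m : ℕ} :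
    initSeg x m = initSeg y m ↔ ∀ i < m, x i = y i := by
  simp [initSeg]

theorem length_initSeg (x : Baire) (m : ℕ) : (initSeg x m).length = m := by
  simp [initSeg]

/-- Every continuous partial function on Baire space has an associate. -/
theorem ContinuousFun.exists_kleene {F : Baire →. Baire} (hF : ContinuousFun F) :
    ∃ p : Baire, ∀ x y, y ∈ F x → y ∈ kleene p x := by
  classical
  let good : ℕ → List ℕ → ℕ → Prop := fun n w k =>
    (∃ x y, y ∈ F x ∧ initSeg x w.length = w) ∧
      ∀ x y, y ∈ F x → initSeg x w.length = w → y n = k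
  let p : Baire := fun c =>
    match (Encodable.decode c : Option (ℕ × List ℕ)) with
    | none => 0
    | some nw => if h : ∃ k, good nw.1 nw.2 k then h.choose + 1 else 0
  have hp : ∀ n w, query p n w = if h : ∃ k, good n w k then h.choose + 1 else 0 := by
    intro n w
    simp only [query, p, Encodable.encodek]
  refine ⟨p, fun x y hxy => mem_kleene.2 fun n => ?_⟩
  have hgood : ∃ m, ∃ k, good n (initSeg x m) k := by
    have hx : F.asSubtype ⟨x, Part.dom_iff_mem.2 ⟨y, hxy⟩⟩ = y := Part.get_eq_of_mem hxy _
    have hc : Continuous fun z : F.Dom => F.asSubtype z n := (continuous_apply n).comp hF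
    have ho : IsOpen {z : F.Dom | F.asSubtype z n = y n} :=
      (isOpen_discrete ({y n} : Set ℕ)).preimage hc
    obtain ⟨O, hO, hOe⟩ := isOpen_induced_iff.1 ho
    have hxO : x ∈ O := by
      have : (⟨x, Part.dom_iff_mem.2 ⟨y, hxy⟩⟩ : F.Dom) ∈ Subtype.val ⁻¹' O := by
        rw [hOe]
        simp [hx]
      exact this
    obtain ⟨I, u, hIu, hsub⟩ := isOpen_pi_iff.1 hO x hxO
    refine ⟨I.sup id + 1, y n, ⟨x, y, hxy, by rw [length_initSeg]⟩, fun x' y' hx'y' hs => ?_⟩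
    rw [length_initSeg, initSeg_eq_iff] at hs
    have hx'O : x' ∈ O := hsub fun i hi => by
      rw [hs i (Nat.lt_succ_of_le (Finset.le_sup (f := id) hi))]
      exact (hIu i hi).2
    have : (⟨x', Part.dom_iff_mem.2 ⟨y', hx'y'⟩⟩ : F.Dom) ∈ {z : F.Dom | F.asSubtype z n = y n} := by
      rw [← hOe]
      exact hx'O
    have hx' : F.asSubtype ⟨x', Part.dom_iff_mem.2 ⟨y', hx'y'⟩⟩ = y' := Part.get_eq_of_mem hx'y' _
    simpa [hx'] using this
  refine ⟨Nat.find hgood, ?_, fun m' hm' => ?_⟩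
  · have hs := Nat.find_spec hgood
    rw [hp, dif_pos hs]
    have := hs.choose_spec.2 x y hxy (by rw [length_initSeg])
    omega
  · rw [hp, dif_neg (Nat.find_min hgood hm')]

/-! ### Represented spaces -/

/-- A represented space: a set with a partial surjection from Baire space, given by its graph;
`names p x` says that `p` lies in the domain of the representation and is mapped to `x`. -/
structure RepSpace where
  carrier : Type
  names : Baire → carrier → Prop
  unique : ∀ {p : Baire} {x y : carrier}, names p x → names p y → x = y
  surj : ∀ x : carrier, ∃ p : Baire, names p x

/-- A partial multivalued function between represented spaces; its domain is the set of all `x`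
for which the set `f x` of admissible values is nonempty. -/
abbrev MultiFun (X Y : RepSpace) : Type := X.carrier → Set Y.carrier

/-- `F` is a realizer of the partial multivalued function `f`. -/
def Realizes {X Y : RepSpace} (F : Baire →. Baire) (f : MultiFun X Y) : Prop :=
  ∀ p x, X.names p x → (f x).Nonempty → ∃ q ∈ F p, ∃ y, Y.names q y ∧ y ∈ f x

/-- A function between represented spaces, viewed as a multivalued one. -/
def single {X Y : RepSpace} (f : X.carrier → Y.carrier) : MultiFun X Y := fun x => {f x}

/-- Continuity of a function between represented spaces: it has a continuous realizer. -/
def IsContinuous {X Y : RepSpace} (f : X.carrier → Y.carrier) : Prop :=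
  ∃ F : Baire →. Baire, ContinuousFun F ∧ Realizes F (single f)

/-- The represented space `C(X, Y)` of continuous functions: a name of `f` is an associate of a
realizer of `f`. -/
def functionSpace (X Y : RepSpace) : RepSpace where
  carrier := {f : X.carrier → Y.carrier // IsContinuous f}
  names p f := Realizes (kleene p) (single f.1)
  unique := by
    rintro p ⟨f, hf⟩ ⟨g, hg⟩ h₁ h₂
    refine Subtype.ext (funext fun x => ?_)
    obtain ⟨a, ha⟩ := X.surj x
    obtain ⟨q, hq, y, hqy, hy⟩ := h₁ a x ha ⟨_, rfl⟩
    obtain ⟨q', hq', y', hqy', hy'⟩ := h₂ a x ha ⟨_, rfl⟩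
    obtain rfl := Part.mem_unique hq hq'
    have : y = f x := hy
    have : y' = g x := hy'
    have := Y.unique hqy hqy'
    simp_all
  surj := by
    rintro ⟨f, F, hF, hFf⟩
    obtain ⟨p, hp⟩ := hF.exists_kleene
    refine ⟨p, fun a x ha hne => ?_⟩
    obtain ⟨q, hq, hy⟩ := hFf a x ha hne
    exact ⟨q, hp a q hq, hy⟩

/-- Sierpiński space on the two truth values: `p` is a name of `⊥` if and only if `p` is
constantly zero, and all other `p` are names of `⊤`. -/
def sierpinski : RepSpace where
  carrier := Prop
  names p s := s ↔ ∃ n, p n ≠ 0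
  unique h₁ h₂ := propext (h₁.trans h₂.symm)
  surj s := by
    classical
    exact ⟨fun _ => if s then 1 else 0, by by_cases h : s <;> simp [h]⟩

/-- The characteristic function of a set. -/
def char (X : RepSpace) (U : Set X.carrier) : X.carrier → sierpinski.carrier := fun x => x ∈ U

/-- `U` is open in `X`: its characteristic function into Sierpiński space is continuous. -/
def IsOpenIn (X : RepSpace) (U : Set X.carrier) : Prop := IsContinuous (char X U)

/-- The represented space `O(X)` of open subsets of `X`, where a set is identified with its
characteristic function in `C(X, Σ)`. -/
def openSets (X : RepSpace) : RepSpace where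
  carrier := {U : Set X.carrier // IsOpenIn X U}
  names p U := (functionSpace X sierpinski).names p ⟨char X U.1, U.2⟩
  unique := by
    rintro p ⟨U, hU⟩ ⟨V, hV⟩ h₁ h₂
    exact Subtype.ext (Subtype.ext_iff.1 ((functionSpace X sierpinski).unique h₁ h₂))
  surj U := (functionSpace X sierpinski).surj ⟨char X U.1, U.2⟩

/-- A set whose preimage under the representation is relatively open is open. -/
theorem isOpenIn_of_names {X : RepSpace} {U : Set X.carrier}
    (h : ∀ p x, X.names p x → x ∈ U →
      ∃ m, ∀ p' x', X.names p' x' → (∀ i < m, p' i = p i) → x' ∈ U) : IsOpenIn X U := by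
  classical
  let f : Baire → Baire := fun p m =>
    if ∀ p' x', X.names p' x' → (∀ i < m, p' i = p i) → x' ∈ U then 1 else 0
  have hf : Continuous f := by
    refine continuous_pi fun m => ?_
    let g : (Fin m → ℕ) → ℕ := fun w =>
      if ∀ p' x', X.names p' x' → (∀ i : Fin m, p' i = w i) → x' ∈ U then 1 else 0
    have hg : (fun p => f p m) = g ∘ fun p : Baire => fun i : Fin m => p i := by
      funext p
      simp only [f, g, Function.comp, Fin.forall_iff]
    rw [hg]
    exact (continuous_of_discreteTopology (f := g)).comp
      (continuous_pi fun i => continuous_apply _)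
  refine ⟨(f : Baire →. Baire), hf.comp continuous_subtype_val, fun p x hp _ => ?_⟩
  refine ⟨f p, by simp, char X U x, ?_, rfl⟩
  change x ∈ U ↔ ∃ n, f p n ≠ 0
  constructor
  · intro hx
    obtain ⟨m, hm⟩ := h p x hp hx
    exact ⟨m, by simp only [f]; rw [if_pos hm]; simp⟩
  · rintro ⟨m, hm⟩
    by_contra hx
    exact hm (if_neg fun hall => hx (hall p x hp fun _ _ => rfl))

/-- The preimage of an open set under the representation is relatively open. -/
theorem IsOpenIn.names {X : RepSpace} {U : Set X.carrier} (hU : IsOpenIn X U) {p : Baire}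
    {x : X.carrier} (hp : X.names p x) (hx : x ∈ U) :
    ∃ m, ∀ p' x', X.names p' x' → (∀ i < m, p' i = p i) → x' ∈ U := by
  obtain ⟨F, hF, hFU⟩ := hU
  obtain ⟨r, hr⟩ := hF.exists_kleene
  obtain ⟨q, hq, s, hqs, hs⟩ := hFU p x hp ⟨_, rfl⟩
  have hs' : s = (x ∈ U) := hs
  subst hs'
  obtain ⟨n, hn⟩ := hqs.1 hx
  obtain ⟨m, hm, hlt⟩ := mem_kleene.1 (hr _ _ hq) n
  refine ⟨m, fun p' x' hp' hpp' => ?_⟩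
  obtain ⟨q', hq', s', hqs', hs'⟩ := hFU p' x' hp' ⟨_, rfl⟩
  have hs'' : s' = (x' ∈ U) := hs'
  subst hs''
  refine hqs'.2 ⟨n, ?_⟩
  have hseg : ∀ j ≤ m, initSeg p' j = initSeg p j := fun j hj =>
    initSeg_eq_iff.2 fun i hi => hpp' i (by omega)
  obtain ⟨m', hm', hlt'⟩ := mem_kleene.1 (hr _ _ hq') n
  have hmm : m' = m := by
    rcases lt_trichotomy m' m with h | h | h
    · have h1 := hlt m' h
      rw [hseg m' h.le] at hm'
      omega
    · exact h
    · have h1 := hlt' m h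
      rw [hseg m le_rfl] at h1
      omega
  subst hmm
  rw [hseg m' le_rfl] at hm'
  omega

/-- For every `A`, the set of all open sets that intersect `A` is open in `O(X)`. -/
theorem isOpenIn_meets (X : RepSpace) (A : Set X.carrier) :
    IsOpenIn (openSets X) {U | (U.1 ∩ A).Nonempty} := by
  refine isOpenIn_of_names fun p U hp hU => ?_
  obtain ⟨x, hxU, hxA⟩ := hU
  obtain ⟨a, ha⟩ := X.surj x
  obtain ⟨q, hq, s, hqs, hs⟩ := hp a x ha ⟨_, rfl⟩
  have hs' : s = (x ∈ U.1) := hs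
  subst hs'
  obtain ⟨n, hn⟩ := hqs.1 hxU
  obtain ⟨m, hm, hlt⟩ := mem_kleene.1 hq n
  refine ⟨(Finset.range (m + 1)).sup (fun j => Encodable.encode (n, initSeg a j)) + 1,
    fun p' U' hp' hpp' => ⟨x, ?_, hxA⟩⟩
  have hquery : ∀ j ≤ m, query p' n (initSeg a j) = query p n (initSeg a j) := fun j hj =>
    hpp' _ (Nat.lt_succ_of_le (Finset.le_sup (f := fun j => Encodable.encode (n, initSeg a j))
      (Finset.mem_range.2 (Nat.lt_succ_of_le hj))))
  obtain ⟨q', hq', s', hqs', hs'⟩ := hp' a x ha ⟨_, rfl⟩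
  have hs'' : s' = (x ∈ U'.1) := hs'
  subst hs''
  refine hqs'.2 ⟨n, ?_⟩
  obtain ⟨m', hm', hlt'⟩ := mem_kleene.1 hq' n
  have hmm : m' = m := by
    rcases lt_trichotomy m' m with h | h | h
    · have h1 := hlt m' h
      have h2 := hquery m' h.le
      omega
    · exact h
    · have h1 := hlt' m h
      have h2 := hquery m le_rfl
      omega
  subst hmm
  have := hquery m' le_rfl
  omega

/-- The represented space `V(X)` of (closed) overt subsets of `X`: a name of the closed set `A` is
a name, in `O(O(X))`, of the set of all open sets that intersect `A`. -/
def overtSets (X : RepSpace) : RepSpace where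
  carrier := {A : Set X.carrier // IsOpenIn X Aᶜ}
  names p A := (openSets (openSets X)).names p
    ⟨{U | (U.1 ∩ A.1).Nonempty}, isOpenIn_meets X A.1⟩
  unique := by
    rintro p ⟨A, hA⟩ ⟨B, hB⟩ h₁ h₂
    have h := Set.ext_iff.1 (Subtype.ext_iff.1 ((openSets (openSets X)).unique h₁ h₂))
    refine Subtype.ext (Set.Subset.antisymm (fun x hx => ?_) fun x hx => ?_)
    · by_contra hxB
      obtain ⟨y, hy, hy'⟩ := (h ⟨Bᶜ, hB⟩).1 ⟨x, hxB, hx⟩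
      exact hy hy'
    · by_contra hxA
      obtain ⟨y, hy, hy'⟩ := (h ⟨Aᶜ, hA⟩).2 ⟨x, hxA, hx⟩
      exact hy hy'
  surj A := (openSets (openSets X)).surj _

/-! ### Weihrauch reducibility and the two problems -/

/-- Weihrauch reducibility: there are computable `H` and `K` such that `p ↦ K ⟨p, G (H p)⟩` is a
realizer of `f` whenever `G` is a realizer of `g`. -/
def WeihrauchLE {X Y U V : RepSpace} (f : MultiFun X Y) (g : MultiFun U V) : Prop :=
  ∃ H K : Baire →. Baire, ComputableFun H ∧ ComputableFun K ∧
    ∀ G : Baire →. Baire, Realizes G g →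
      Realizes (fun p => (H p).bind fun a => (G a).bind fun b => K (pair p b)) f

/-- Weihrauch equivalence. -/
def WeihrauchEquiv {X Y U V : RepSpace} (f : MultiFun X Y) (g : MultiFun U V) : Prop :=
  WeihrauchLE f g ∧ WeihrauchLE g f

/-- Overt choice: given a nonempty closed `A` in `V(X)`, find an element of `A`. -/
def VC (X : RepSpace) : MultiFun (overtSets X) X := fun A => A.1

/-- Baire space, represented by the identity. -/
def baireSpace : RepSpace where
  carrier := Baire
  names p x := p = x
  unique h₁ h₂ := h₁.symm.trans h₂
  surj x := ⟨x, rfl⟩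

/-- The discrete space `{0, 1}`: a name of `i` is any sequence with first entry `i`. -/
def twoSpace : RepSpace where
  carrier := Fin 2
  names p i := p 0 = (i : ℕ)
  unique h₁ h₂ := Fin.ext (h₁.symm.trans h₂)
  surj i := ⟨fun _ => i, rfl⟩

open Classical in
/-- `LPO r = 1` if `r k = 0` for some `k`, and `LPO r = 0` otherwise. -/
noncomputable def LPO : MultiFun baireSpace twoSpace :=
  single (X := baireSpace) (Y := twoSpace)
    (fun r : Baire => (if ∃ k, r k = 0 then 1 else 0 : Fin 2))

/-! ### The space `S_min` -/

/-- The set `{(∞, ∞)} ∪ (ℕ × {∞}) ∪ ℕ²`. -/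
inductive SminPoint : Type
  | inf : SminPoint
  | lim (a : ℕ) : SminPoint
  | pt (a b : ℕ) : SminPoint

/-- The sequence `i 0^ω`. -/
def zeroTail (i : ℕ) : Baire := fun n => if n = 0 then i else 0

/-- The sequence `i 0^j 1^ω`. -/
def oneTail (i j : ℕ) : Baire := fun n => if n = 0 then i else if n ≤ j then 0 else 1

/-- The graph of the representation of `S_min`. -/
def SminNames (p : Baire) : SminPoint → Prop
  | .inf => p = zeroTail 0
  | .lim a => p = oneTail 0 a ∨ p = zeroTail (a + 1)
  | .pt a b => p = oneTail (a + 1) b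

theorem zeroTail_ne_oneTail (i i' j : ℕ) : zeroTail i ≠ oneTail i' j := fun h => by
  have := congrFun h (j + 1)
  simp [zeroTail, oneTail] at this

theorem zeroTail_inj {i i' : ℕ} (h : zeroTail i = zeroTail i') : i = i' := by
  simpa [zeroTail] using congrFun h 0

theorem oneTail_inj {i j i' j' : ℕ} (h : oneTail i j = oneTail i' j') : i = i' ∧ j = j' := by
  refine ⟨by simpa [oneTail] using congrFun h 0, ?_⟩
  rcases lt_trichotomy j j' with hj | hj | hj
  · have := congrFun h (j + 1)
    simp [oneTail, Nat.succ_le_of_lt hj] at this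
  · exact hj
  · have := congrFun h (j' + 1)
    simp [oneTail, Nat.succ_le_of_lt hj] at this

/-- The represented space `S_min`. -/
def Smin : RepSpace where
  carrier := SminPoint
  names := SminNames
  unique := by
    intro p x y hx hy
    rcases x with _ | a | ⟨a, b⟩ <;> rcases y with _ | a' | ⟨a', b'⟩ <;>
      simp only [SminNames] at hx hy
    · rfl
    · rcases hy with hy | hy
      · exact absurd (hx.symm.trans hy) (zeroTail_ne_oneTail _ _ _)
      · exact absurd (zeroTail_inj (hx.symm.trans hy)) (by omega)
    · exact absurd (hx.symm.trans hy) (zeroTail_ne_oneTail _ _ _)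
    · rcases hx with hx | hx
      · exact absurd (hy.symm.trans hx) (zeroTail_ne_oneTail _ _ _)
      · exact absurd (zeroTail_inj (hx.symm.trans hy)) (by omega)
    · rcases hx with hx | hx <;> rcases hy with hy | hy
      · rw [(oneTail_inj (hx.symm.trans hy)).2]
      · exact absurd (hy.symm.trans hx) (zeroTail_ne_oneTail _ _ _)
      · exact absurd (hx.symm.trans hy) (zeroTail_ne_oneTail _ _ _)
      · rw [Nat.succ_injective (zeroTail_inj (hx.symm.trans hy))]
    · rcases hx with hx | hx
      · exact absurd (oneTail_inj (hx.symm.trans hy)).1 (by omega)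
      · exact absurd (hx.symm.trans hy) (zeroTail_ne_oneTail _ _ _)
    · exact absurd (hy.symm.trans hx) (zeroTail_ne_oneTail _ _ _)
    · rcases hy with hy | hy
      · exact absurd (oneTail_inj (hx.symm.trans hy)).1 (by omega)
      · exact absurd (hy.symm.trans hx) (zeroTail_ne_oneTail _ _ _)
    · obtain ⟨h₁, h₂⟩ := oneTail_inj (hx.symm.trans hy)
      rw [Nat.succ_injective h₁, h₂]
  surj := by
    rintro (_ | a | ⟨a, b⟩)
    · exact ⟨_, rfl⟩
    · exact ⟨_, Or.inr rfl⟩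
    · exact ⟨_, rfl⟩

/-- The basic open sets of the topology of `S_min`. -/
inductive SminBasic : Set SminPoint → Prop
  | pt (a b : ℕ) : SminBasic {.pt a b}
  | lim (a b : ℕ) : SminBasic ({.lim a} ∪ {x | ∃ j ≥ b, x = .pt a j})
  | inf (a : ℕ) (l : ℕ → ℕ) : SminBasic
      ({.inf} ∪ {x | ∃ i ≥ a, x = .lim i} ∪ {x | ∃ i ≥ a, ∃ j ≥ l i, x = .pt i j})

theorem smin_near_oneTail {i b : ℕ} {p' : Baire} {x x' : SminPoint}
    (hx : SminNames (oneTail i b) x) (hp' : SminNames p' x')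
    (h : ∀ k < b + 2, p' k = oneTail i b k) : x' = x := by
  suffices hpp : p' = oneTail i b by
    subst hpp
    exact Smin.unique hp' hx
  have h0 := h 0 (by omega)
  have h1 := h (b + 1) (by omega)
  simp only [oneTail] at h0 h1
  have hz : ∀ c, p' ≠ zeroTail c := fun c hc => by simp [hc, zeroTail] at h1
  have ho : ∀ c d, p' = oneTail c d → p' = oneTail i b := fun c d hc => by
    rw [hc] at h h0 ⊢
    have hc' : c = i := by simpa [oneTail] using h0
    subst hc'
    have hd : d = b := by
      rcases lt_trichotomy d b with hd | hd | hd
      · have := h (d + 1) (by omega)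
        simp [oneTail, Nat.succ_le_of_lt hd] at this
      · exact hd
      · have := h (b + 1) (by omega)
        simp [oneTail, Nat.succ_le_of_lt hd] at this
    rw [hd]
  rcases x' with _ | a | ⟨a, c⟩
  · exact absurd hp' (hz _)
  · rcases hp' with hp' | hp'
    · exact ho _ _ hp'
    · exact absurd hp' (hz _)
  · exact ho _ _ hp'

theorem smin_near_zeroTail {i b : ℕ} {p' : Baire} {x' : SminPoint} (hp' : SminNames p' x')
    (h : ∀ k < b + 1, p' k = zeroTail i k) :
    (i = 0 ∧ (x' = .inf ∨ ∃ a ≥ b, x' = .lim a)) ∨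
      ∃ a, i = a + 1 ∧ (x' = .lim a ∨ ∃ j ≥ b, x' = .pt a j) := by
  have h0 := h 0 (by omega)
  have ho : ∀ c d, p' = oneTail c d → b ≤ d := fun c d hc => by
    by_contra hd
    have := h (d + 1) (by omega)
    simp [hc, oneTail, zeroTail] at this
  rcases x' with _ | a | ⟨a, c⟩
  · have hp : p' = _ := hp'
    simp [hp, zeroTail] at h0
    exact Or.inl ⟨h0.symm, Or.inl rfl⟩
  · rcases hp' with hp | hp
    · have := ho _ _ hp
      simp [hp, zeroTail, oneTail] at h0
      exact Or.inl ⟨h0.symm, Or.inr ⟨a, this, rfl⟩⟩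
    · simp [hp, zeroTail] at h0
      exact Or.inr ⟨a, h0.symm, Or.inl rfl⟩
  · have hp : p' = _ := hp'
    have := ho _ _ hp
    simp [hp, zeroTail, oneTail] at h0
    exact Or.inr ⟨a, h0.symm, Or.inr ⟨c, this, rfl⟩⟩

/-- Basic open sets have relatively open preimages under the representation. -/
theorem smin_basic_names {V : Set SminPoint} (hV : SminBasic V) (p : Baire) (x : SminPoint)
    (hp : SminNames p x) (hx : x ∈ V) :
    ∃ m, ∀ p' x', SminNames p' x' → (∀ i < m, p' i = p i) → x' ∈ V := by
  have iso : ∀ i b, p = oneTail i b →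
      ∃ m, ∀ p' x', SminNames p' x' → (∀ i < m, p' i = p i) → x' ∈ V := fun i b hpe => by
    subst hpe
    exact ⟨b + 2, fun p' x' hp' h => smin_near_oneTail hp hp' h ▸ hx⟩
  rcases x with _ | a | ⟨a, c⟩
  · have hpe : p = zeroTail 0 := hp
    subst hpe
    rcases hV with ⟨c, d⟩ | ⟨c, d⟩ | ⟨c, l⟩
    · simp at hx
    · simp at hx
    · refine ⟨c + 1, fun p' x' hp' h => ?_⟩
      rcases smin_near_zeroTail hp' h with ⟨-, rfl | ⟨a, ha, rfl⟩⟩ | ⟨a, ha, -⟩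
      · simp
      · simpa using ha
      · omega
  · rcases hp with hpe | hpe
    · exact iso _ _ hpe
    subst hpe
    rcases hV with ⟨c, d⟩ | ⟨c, d⟩ | ⟨c, l⟩
    · simp at hx
    · refine ⟨d + 1, fun p' x' hp' h => ?_⟩
      have hac : a = c := by simpa using hx
      subst hac
      rcases smin_near_zeroTail hp' h with ⟨h0, -⟩ | ⟨a', ha, rfl | ⟨j, hj, rfl⟩⟩
      · omega
      · obtain rfl : a = a' := by omega
        simp
      · obtain rfl : a = a' := by omega
        simpa using hj
    · refine ⟨l a + 1, fun p' x' hp' h => ?_⟩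
      have hac : c ≤ a := by simpa using hx
      rcases smin_near_zeroTail hp' h with ⟨h0, -⟩ | ⟨a', ha, rfl | ⟨j, hj, rfl⟩⟩
      · omega
      · obtain rfl : a = a' := by omega
        simpa using hac
      · obtain rfl : a = a' := by omega
        simp [hac, hj]
  · exact iso _ _ hp

/-- The topology of `S_min`. -/
instance : TopologicalSpace SminPoint := TopologicalSpace.generateFrom {U | SminBasic U}

/-- The representation of `S_min` induces this topology. -/
theorem isOpenIn_Smin_iff (U : Set SminPoint) : IsOpenIn Smin U ↔ IsOpen U := by
  constructor
  · intro hU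
    have key : ∀ {p : Baire} {x : SminPoint}, SminNames p x → x ∈ U →
        ∃ m, ∀ p' x', SminNames p' x' → (∀ i < m, p' i = p i) → x' ∈ U :=
      fun hp hx => IsOpenIn.names hU hp hx
    have hlim : ∀ a, SminPoint.lim a ∈ U → ∃ b, ∀ j ≥ b, SminPoint.pt a j ∈ U := by
      intro a ha
      obtain ⟨m, hm⟩ := key (p := zeroTail (a + 1)) (x := .lim a) (Or.inr rfl) ha
      refine ⟨m, fun j hj => hm _ (.pt a j) rfl fun i hi => ?_⟩
      simp only [oneTail, zeroTail]
      rw [if_pos (by omega : i ≤ j)]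
    rw [isOpen_iff_mem_nhds]
    have hb : ∀ {V : Set SminPoint} {x}, SminBasic V → x ∈ V → V ⊆ U → U ∈ nhds x :=
      fun hV hx hVU => Filter.mem_of_superset
        ((TopologicalSpace.isOpen_generateFrom_of_mem hV).mem_nhds hx) hVU
    rintro (_ | a | ⟨a, b⟩) hx
    · obtain ⟨m, hm⟩ := key (p := zeroTail 0) (x := .inf) rfl hx
      have hl : ∀ i ≥ m, SminPoint.lim i ∈ U := fun i hi =>
        hm (oneTail 0 i) (.lim i) (Or.inl rfl) fun k hk => by
          simp only [oneTail, zeroTail]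
          rw [if_pos (by omega : k ≤ i)]
      have : ∀ i, ∃ b, i ≥ m → ∀ j ≥ b, SminPoint.pt i j ∈ U := fun i => by
        by_cases hi : i ≥ m
        · obtain ⟨b, hb⟩ := hlim i (hl i hi)
          exact ⟨b, fun _ => hb⟩
        · exact ⟨0, fun h => absurd h hi⟩
      choose l hl' using this
      refine hb (SminBasic.inf m l) (by simp) ?_
      rintro y ((rfl | ⟨i, hi, rfl⟩) | ⟨i, hi, j, hj, rfl⟩)
      · exact hx
      · exact hl i hi
      · exact hl' i hi j hj
    · obtain ⟨b, hlb⟩ := hlim a hx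
      refine hb (SminBasic.lim a b) (by simp) ?_
      rintro y (rfl | ⟨j, hj, rfl⟩)
      · exact hx
      · exact hlb j hj
    · refine hb (SminBasic.pt a b) (by simp) ?_
      rintro y rfl
      exact hx
  · intro hU
    have step : ∀ (V : Set SminPoint), TopologicalSpace.GenerateOpen {U | SminBasic U} V →
        ∀ p x, SminNames p x → x ∈ V →
          ∃ m, ∀ p' x', SminNames p' x' → (∀ i < m, p' i = p i) → x' ∈ V := by
      intro V hV
      induction hV with
      | basic V hV => exact smin_basic_names hV
      | univ => exact fun _ _ _ _ => ⟨0, fun _ _ _ _ => trivial⟩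
      | inter V W _ _ ihV ihW =>
        intro p x hp hx
        obtain ⟨m, hm⟩ := ihV p x hp hx.1
        obtain ⟨n, hn⟩ := ihW p x hp hx.2
        exact ⟨max m n, fun p' x' hp' h =>
          ⟨hm p' x' hp' fun i hi => h i (lt_max_of_lt_left hi),
            hn p' x' hp' fun i hi => h i (lt_max_of_lt_right hi)⟩⟩
      | sUnion S _ ih =>
        rintro p x hp ⟨V, hVS, hx⟩
        obtain ⟨m, hm⟩ := ih V hVS p x hp hx
        exact ⟨m, fun p' x' hp' h => ⟨V, hVS, hm p' x' hp' h⟩⟩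
    exact isOpenIn_of_names (X := Smin) (step U hU)

end OvertChoice

namespace OvertChoice

open Encodable

/-! ### Primitive recursive predicates with bounded quantifiers -/

section Primrec

variable {α : Type*} [Primcodable α]

/-! Two facts carry the proof. Acceptance by an open set uses only finitely many entries of its name
and of the point's name (`Accepts.congr`). And (a, ∞) has two names: 00^a1^ω, close to the name of
(∞, ∞), and (a+1)0^ω, close to the names of (a, j) for large j. Membership in an open set cannot
depend on the name used, so information passes from (∞, ∞) through (a, ∞) to isolated points.

For `LPO_le_VC`, send r to {(∞, ∞)} if it has no zero, and to {(k, t) | k ∈ ℕ} if its first zero is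
at t. The first entry of a name of any element tells the cases apart. An overt name is computable
without knowing the case (`meets_lpoSet_iff`): an open U containing (∞, ∞) contains some (k, ∞),
hence (k, t) for all large t, and finitely much of a name of U shows this. If r has no zero up to
that stage, U meets the set whatever r does later.

For `VC_le_LPO`, isolated points are open, so an overt name of A lets one search for them, and a
single question to LPO tells whether the search succeeds. If it does, it yields an element.
Otherwise A lies in the sequence of the (a, ∞) together with its limit (∞, ∞), and an element is
computable (`exists_limValue`): for i = 0, 1, …, wait until A is seen to meet a neighbourhood of (i,
∞) or one of the tail beyond i; write a further 0 in the latter case, switch to 1s for good in the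
former. The result is some 00^j1^ω, or 00^ω, which is correct because A is closed. -/

theorem primrecPred_exists_lt {R : α → ℕ → Prop} {f : α → ℕ} (hR : PrimrecRel R)
    (hf : Primrec f) : PrimrecPred fun a => ∃ k < f a, R a k :=
  (hR.swap.exists_mem_list.comp (Primrec.list_range.comp hf) Primrec.id).of_eq fun a => by
    simp [Function.swap]

theorem primrecPred_forall_lt {R : α → ℕ → Prop} {f : α → ℕ} (hR : PrimrecRel R)
    (hf : Primrec f) : PrimrecPred fun a => ∀ k < f a, R a k :=
  (hR.swap.forall_mem_list.comp (Primrec.list_range.comp hf) Primrec.id).of_eq fun a => by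
    simp [Function.swap]

theorem primrec_initSeg {f : α → ℕ → ℕ} {g : α → ℕ} (hf : Primrec₂ f) (hg : Primrec g) :
    Primrec fun a => initSeg (f a) (g a) :=
  Primrec.list_map (Primrec.list_range.comp hg) hf

theorem primrec_query {f : α → ℕ → ℕ} {g : α → ℕ} {w : α → List ℕ} (hf : Primrec₂ f)
    (hg : Primrec g) (hw : Primrec w) : Primrec fun a => query (f a) (g a) (w a) :=
  hf.comp Primrec.id (Primrec.encode.comp (hg.pair hw))

theorem primrec_zeroTail {f g : α → ℕ} (hf : Primrec f) (hg : Primrec g) :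
    Primrec fun a => zeroTail (f a) (g a) :=
  Primrec.ite (Primrec.eq.comp hg (.const 0)) hf (.const 0)

theorem primrec_oneTail {f g h : α → ℕ} (hf : Primrec f) (hg : Primrec g) (hh : Primrec h) :
    Primrec fun a => oneTail (f a) (g a) (h a) :=
  Primrec.ite (Primrec.eq.comp hh (.const 0)) hf
    (Primrec.ite (Primrec.nat_le.comp hh hg) (.const 0) (.const 1))

end Primrec

/-! ### Associates given by stages -/

/-- The sequence that continues a finite word by zeros. -/
def ext (w : List ℕ) : Baire := fun i => w.getD i 0

theorem ext_initSeg {x : Baire} {m i : ℕ} (h : i < m) : ext (initSeg x m) i = x i := by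
  simp [ext, initSeg, h]

theorem primrec_ext : Primrec₂ ext := Primrec.list_getD 0

/-- The associate that, having read `s` entries of `x`, knows entry `n` of the value to be `k`
when `κ x s n = k + 1`. -/
def assoc (κ : Baire → ℕ → ℕ → ℕ) : Baire := fun c =>
  match (decode c : Option (ℕ × List ℕ)) with
  | none => 0
  | some q => κ (ext q.2) q.2.length q.1

/-- `κ x s n` depends only on the first `s` entries of `x`. -/
def IsLocal (κ : Baire → ℕ → ℕ → ℕ) : Prop :=
  ∀ x x' s n, (∀ i < s, x i = x' i) → κ x s n = κ x' s n

theorem query_assoc {κ : Baire → ℕ → ℕ → ℕ} (hκ : IsLocal κ) (x : Baire) (s n : ℕ) :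
    query (assoc κ) n (initSeg x s) = κ x s n := by
  simp only [query, assoc, encodek, length_initSeg]
  exact hκ _ _ _ _ fun i hi => ext_initSeg hi

/-- No monotonicity in the stage is needed: every nonzero value is already the right one, so it does
not matter which stage answers first. -/
theorem mem_kleene_assoc {κ : Baire → ℕ → ℕ → ℕ} (hκ : IsLocal κ) {x y : Baire}
    (h : ∀ n, ∃ s, κ x s n ≠ 0) (hy : ∀ n s, κ x s n = 0 ∨ κ x s n = y n + 1) :
    y ∈ kleene (assoc κ) x := by
  refine mem_kleene.2 fun n => ?_
  simp only [query_assoc hκ]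
  classical
  refine ⟨Nat.find (h n), (hy n _).resolve_left (Nat.find_spec (h n)), fun m' hm' => ?_⟩
  simpa using Nat.find_min (h n) hm'

/-- The parameter matters: associates of tests indexed by numbers or by finite words are later
consulted uniformly inside other primitive recursive predicates. -/
theorem primrec_assoc {α : Type*} [Primcodable α] {κ : α → Baire → ℕ → ℕ → ℕ}
    (hκ : Primrec fun q : α × (ℕ × List ℕ) => κ q.1 (ext q.2.2) q.2.2.length q.2.1) :
    Primrec₂ fun a => assoc (κ a) := by
  have h : Primrec fun q : α × ℕ =>
      Option.casesOn (motive := fun _ => ℕ) (decode q.2 : Option (ℕ × List ℕ)) 0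
        fun r => κ q.1 (ext r.2) r.2.length r.1 :=
    Primrec.option_casesOn (Primrec.decode.comp .snd) (.const 0)
      (hκ.comp ((Primrec.fst.comp .fst).pair .snd)).to₂
  refine Primrec.of_eq h fun q => ?_
  simp only [assoc]
  cases (decode q.2 : Option (ℕ × List ℕ)) <;> rfl

theorem computableFun_kleene {p : Baire} (hp : Computable p) : ComputableFun (kleene p) :=
  ⟨p, hp, fun _ _ h => h⟩

/-- The modulus n + 2 makes entry 1 available even for output 0; in a pair, entry 1 is the first
entry of the second component. -/
theorem computableFun_coe {F : Baire → Baire}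
    (hloc : ∀ x x' n, (∀ i < n + 2, x i = x' i) → F x n = F x' n)
    (hF : Primrec₂ fun w n => F (ext w) n) : ComputableFun (F : Baire →. Baire) := by
  let κ : Baire → ℕ → ℕ → ℕ := fun x s n => if s < n + 2 then 0 else F x n + 1
  have hκ : IsLocal κ := fun x x' s n h => by
    simp only [κ]
    split_ifs with hs
    · rfl
    · rw [hloc x x' n fun i hi => h i (by omega)]
  have hp : Primrec₂ fun _ : Unit => assoc κ := by
    refine primrec_assoc ?_
    exact Primrec.ite
      (Primrec.nat_lt.comp (Primrec.list_length.comp (Primrec.snd.comp .snd))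
        (Primrec.nat_add.comp (Primrec.fst.comp .snd) (.const 2)))
      (.const 0) (Primrec.succ.comp (hF.comp (Primrec.snd.comp .snd) (Primrec.fst.comp .snd)))
  refine ⟨assoc κ, (hp.comp (.const ()) .id).to_comp, fun x y hy => ?_⟩
  obtain rfl : y = F x := by simpa using hy
  refine mem_kleene_assoc hκ (fun n => ⟨n + 2, by simp [κ]⟩) fun n s => ?_
  simp only [κ]
  split_ifs <;> simp

/-! ### Acceptance within a stage -/

/-- The partial function with associate `p`, at `x`, is seen to take a nonzero value, on the basis
of the first `s` entries of `p` and of `x`. -/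
def Accepts (p x : Baire) (s : ℕ) : Prop :=
  ∃ n < s, ∃ k < s, 2 ≤ query p n (initSeg x k) ∧ (∀ j < k, query p n (initSeg x j) = 0) ∧
    ∀ j < k + 1, encode (n, initSeg x j) < s

theorem Accepts.mono {p x : Baire} {s t : ℕ} (h : Accepts p x s) (hst : s ≤ t) :
    Accepts p x t := by
  obtain ⟨n, hn, k, hk, h1, h2, h3⟩ := h
  exact ⟨n, by omega, k, by omega, h1, h2, fun j hj => (h3 j hj).trans_le hst⟩

/-- In `Accepts` the bound on `k` confines the use of `x`, and the bound on the codes confines the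
use of `p`, to the first `s` entries. This is what allows acceptance to be transferred between
nearby points. -/
theorem Accepts.congr {p p' x x' : Baire} {s : ℕ} (h : Accepts p x s)
    (hp : ∀ i < s, p i = p' i) (hx : ∀ i < s, x i = x' i) : Accepts p' x' s := by
  obtain ⟨n, hn, k, hk, h1, h2, h3⟩ := h
  have hseg : ∀ j < k + 1, initSeg x' j = initSeg x j := fun j hj =>
    initSeg_eq_iff.2 fun i hi => (hx i (by omega)).symm
  have hq : ∀ j < k + 1, query p' n (initSeg x' j) = query p n (initSeg x j) := fun j hj => by
    rw [hseg j hj]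
    exact (hp _ (h3 j hj)).symm
  refine ⟨n, hn, k, hk, ?_, fun j hj => ?_, fun j hj => ?_⟩
  · rw [hq k (by omega)]
    exact h1
  · rw [hq j (by omega)]
    exact h2 j hj
  · rw [hseg j hj]
    exact h3 j hj

theorem accepts_congr {p p' x x' : Baire} {s : ℕ}
    (hp : ∀ i < s, p i = p' i) (hx : ∀ i < s, x i = x' i) : Accepts p x s ↔ Accepts p' x' s :=
  ⟨fun h => h.congr hp hx,
    fun h => h.congr (fun i hi => (hp i hi).symm) fun i hi => (hx i hi).symm⟩

/-- A query answer c + 1 announces the output c, so nonzero outputs are the answers that are at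
least 2. The zeros before `k` make `k` the stage at which `kleene` takes its answer. -/
theorem exists_accepts_iff {p x y : Baire} (hy : y ∈ kleene p x) :
    (∃ s, Accepts p x s) ↔ ∃ n, y n ≠ 0 := by
  rw [mem_kleene] at hy
  constructor
  · rintro ⟨s, n, -, k, -, h1, h2, -⟩
    obtain ⟨m, hm, hlt⟩ := hy n
    refine ⟨n, ?_⟩
    rcases lt_trichotomy k m with h | rfl | h
    · have := hlt k h
      omega
    · omega
    · have := h2 m h
      omega
  · rintro ⟨n, hn⟩
    obtain ⟨m, hm, hlt⟩ := hy n
    -- A stage above `n`, `m` and the codes of all queries made up to `m`.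
    refine ⟨(n + m + 1) + (Finset.range (m + 1)).sup (fun j => encode (n, initSeg x j)),
      n, by omega, m, by omega, by omega, hlt, fun j hj => ?_⟩
    have : encode (n, initSeg x j) ≤ _ :=
      Finset.le_sup (f := fun j => encode (n, initSeg x j)) (Finset.mem_range.2 hj)
    omega

theorem primrecPred_accepts {α : Type*} [Primcodable α] {f g : α → ℕ → ℕ} {s : α → ℕ}
    (hf : Primrec₂ f) (hg : Primrec₂ g) (hs : Primrec s) :
    PrimrecPred fun a => Accepts (f a) (g a) (s a) := by
  have hg' : Primrec₂ fun (q : ((α × ℕ) × ℕ) × ℕ) => g q.1.1.1 :=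
    hg.comp₂ (Primrec.fst.comp (Primrec.fst.comp (Primrec.fst.comp .fst))).to₂ .right
  have hf' : Primrec₂ fun (q : ((α × ℕ) × ℕ) × ℕ) => f q.1.1.1 :=
    hf.comp₂ (Primrec.fst.comp (Primrec.fst.comp (Primrec.fst.comp .fst))).to₂ .right
  have hseg : Primrec fun q : ((α × ℕ) × ℕ) × ℕ => initSeg (g q.1.1.1) q.2 :=
    primrec_initSeg hg' .snd
  have hn : Primrec fun q : ((α × ℕ) × ℕ) × ℕ => q.1.1.2 :=
    Primrec.snd.comp (Primrec.fst.comp .fst)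
  have hq : Primrec fun q : ((α × ℕ) × ℕ) × ℕ => query (f q.1.1.1) q.1.1.2 (initSeg (g q.1.1.1) q.2) :=
    primrec_query hf' hn hseg
  have hS : Primrec fun q : (α × ℕ) × ℕ => s q.1.1 := hs.comp (Primrec.fst.comp .fst)
  have hdiag : Primrec fun q : (α × ℕ) × ℕ => (q, q.2) := Primrec.id.pair .snd
  refine primrecPred_exists_lt (R := fun a n => ∃ k < s a, _) (PrimrecPred.primrecRel
    (p := fun q : α × ℕ => ∃ k < s q.1, 2 ≤ query (f q.1) q.2 (initSeg (g q.1) k) ∧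
      (∀ j < k, query (f q.1) q.2 (initSeg (g q.1) j) = 0) ∧
      ∀ j < k + 1, encode (q.2, initSeg (g q.1) j) < s q.1) ?_) hs
  refine primrecPred_exists_lt (PrimrecPred.primrecRel
    (p := fun q : (α × ℕ) × ℕ => 2 ≤ query (f q.1.1) q.1.2 (initSeg (g q.1.1) q.2) ∧
      (∀ j < q.2, query (f q.1.1) q.1.2 (initSeg (g q.1.1) j) = 0) ∧
      ∀ j < q.2 + 1, encode (q.1.2, initSeg (g q.1.1) j) < s q.1.1) ?_) (hs.comp .fst)
  refine PrimrecPred.and (Primrec.nat_le.comp (.const 2) (hq.comp hdiag)) (PrimrecPred.and ?_ ?_)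
  · exact primrecPred_forall_lt (PrimrecPred.primrecRel
      (p := fun q : ((α × ℕ) × ℕ) × ℕ => query (f q.1.1.1) q.1.1.2 (initSeg (g q.1.1.1) q.2) = 0)
      (Primrec.eq.comp hq (.const 0))) .snd
  · exact primrecPred_forall_lt (PrimrecPred.primrecRel
      (p := fun q : ((α × ℕ) × ℕ) × ℕ => encode (q.1.1.2, initSeg (g q.1.1.1) q.2) < s q.1.1.1)
      (Primrec.nat_lt.comp (Primrec.encode.comp (hn.pair hseg)) (hS.comp .fst)))
      (Primrec.succ.comp .snd)

/-! ### Names of open sets -/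

/-- The name `a` of `x` is arbitrary, so acceptance on one name of a point forces acceptance on its
other names, possibly at a different stage. -/
theorem mem_iff_exists_accepts {X : RepSpace} {p : Baire} {U : (openSets X).carrier}
    (hp : (openSets X).names p U) {a : Baire} {x : X.carrier} (ha : X.names a x) :
    x ∈ U.1 ↔ ∃ s, Accepts p a s := by
  obtain ⟨q, hq, s, hqs, hs⟩ := hp a x ha ⟨_, rfl⟩
  have hs' : s = (x ∈ U.1) := hs
  subst hs'
  rw [exists_accepts_iff hq]
  exact hqs

open Classical in
/-- The associate whose output at stage `s`, on input `x`, is `1` or `0` according to whether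
`T x s` holds. -/
noncomputable def staged (T : Baire → ℕ → Prop) : Baire :=
  assoc fun x s n => if s < n then 0 else if T x n then 2 else 1

/-- `T x s` depends only on the first `s` entries of `x`. -/
def IsLocalPred (T : Baire → ℕ → Prop) : Prop :=
  ∀ x x' s, (∀ i < s, x i = x' i) → T x s → T x' s

theorem IsLocalPred.iff {T : Baire → ℕ → Prop} (hT : IsLocalPred T) {x x' : Baire} {s : ℕ}
    (h : ∀ i < s, x i = x' i) : T x s ↔ T x' s :=
  ⟨hT _ _ _ h, hT _ _ _ fun i hi => (h i hi).symm⟩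

/-- Output `n` is withheld until `n` entries are read; locality then makes the test on the word
agree with the test on the whole sequence. -/
theorem staged_names {X : RepSpace} {T : Baire → ℕ → Prop} (hT : IsLocalPred T)
    {U : (openSets X).carrier} (hU : ∀ a x, X.names a x → (x ∈ U.1 ↔ ∃ n, T a n)) :
    (openSets X).names (staged T) U := by
  classical
  intro a x ha _
  refine ⟨fun n => if T a n then 1 else 0, mem_kleene_assoc (fun x x' s n h => ?_)
    (fun n => ⟨n, ?_⟩) (fun n s => ?_), x ∈ U.1, ?_, rfl⟩
  · split_ifs with h0 h1 h2 h2
    · rfl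
    · rfl
    · exact absurd ((hT.iff fun i hi => h i (by omega)).1 h1) h2
    · exact absurd ((hT.iff fun i hi => h i (by omega)).2 h2) h1
    · rfl
  · split_ifs <;> simp_all
  · split_ifs <;> simp
  · change x ∈ U.1 ↔ ∃ n, (if T a n then 1 else 0) ≠ 0
    simp [hU a x ha]

theorem isOpenIn_of_isLocalPred {X : RepSpace} {T : Baire → ℕ → Prop} (hT : IsLocalPred T)
    {U : Set X.carrier} (hU : ∀ a x, X.names a x → (x ∈ U ↔ ∃ n, T a n)) : IsOpenIn X U := by
  refine isOpenIn_of_names fun p x hp hx => ?_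
  obtain ⟨n, hn⟩ := (hU p x hp).1 hx
  exact ⟨n, fun p' x' hp' h => (hU p' x' hp').2 ⟨n, hT _ _ _ (fun i hi => (h i hi).symm) hn⟩⟩

theorem primrec_staged {α : Type*} [Primcodable α] {T : α → Baire → ℕ → Prop}
    (hT : PrimrecPred fun q : α × (ℕ × List ℕ) => T q.1 (ext q.2.2) q.2.1) :
    Primrec₂ fun a => staged (T a) := by
  classical
  exact primrec_assoc (Primrec.ite
    (Primrec.nat_lt.comp (Primrec.list_length.comp (Primrec.snd.comp .snd))
      (Primrec.fst.comp .snd)) (.const 0) (Primrec.ite hT (.const 2) (.const 1)))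

/-! ### `LPO` is reducible to overt choice on `S_min` -/

/-- The singleton of `(∞, ∞)` if `r` has no zero, and `{(k, t) | k ∈ ℕ}` if `t` is its first zero. -/
def lpoSet (r : Baire) : Set SminPoint :=
  {x | (x = .inf ∧ ∀ i, r i ≠ 0) ∨ ∃ k t, x = .pt k t ∧ r t = 0 ∧ ∀ i < t, r i ≠ 0}

theorem inf_mem_lpoSet {r : Baire} : SminPoint.inf ∈ lpoSet r ↔ ∀ i, r i ≠ 0 := by
  simp [lpoSet]

theorem lim_notMem_lpoSet (r : Baire) (a : ℕ) : SminPoint.lim a ∉ lpoSet r := by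
  simp [lpoSet]

/-- Names ending in 1s are isolated among names, so only zero tails need care. Near 00^ω there are
only names of (∞, ∞) and of limit points; near (a+1)0^ω only names of (a, ∞) and of points of column
a, which contains at most one element of the set. -/
theorem isOpenIn_compl_lpoSet (r : Baire) : IsOpenIn Smin (lpoSet r)ᶜ := by
  have iso : ∀ i b x, SminNames (oneTail i b) x → x ∈ (lpoSet r)ᶜ → ∃ m, ∀ p' x', Smin.names p' x' →
      (∀ k < m, p' k = oneTail i b k) → x' ∈ (lpoSet r)ᶜ := fun i b x hx hxr =>
    ⟨b + 2, fun p' x' hp' h => smin_near_oneTail hx hp' h ▸ hxr⟩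
  have huniq : ∀ {t t'}, r t = 0 → (∀ i < t, r i ≠ 0) → r t' = 0 → (∀ i < t', r i ≠ 0) → t = t' :=
    fun {t t'} h1 h2 h3 h4 => by
      rcases lt_trichotomy t t' with h | h | h
      · exact absurd h1 (h4 t h)
      · exact h
      · exact absurd h3 (h2 t' h)
  refine isOpenIn_of_names fun p x hp hx => ?_
  rcases x with _ | a | ⟨a, b⟩
  · obtain rfl : p = zeroTail 0 := hp
    have h0 : ¬ ∀ i, r i ≠ 0 := fun h => hx (Or.inl ⟨rfl, h⟩)
    refine ⟨1, fun p' x' hp' h hx' => ?_⟩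
    rcases smin_near_zeroTail (b := 0) hp' h with ⟨-, rfl | ⟨a, -, rfl⟩⟩ | ⟨a, ha, -⟩
    · exact h0 (inf_mem_lpoSet.1 hx')
    · exact lim_notMem_lpoSet r a hx'
    · omega
  · rcases hp with rfl | rfl
    · exact iso _ _ (.lim a) (Or.inl rfl) hx
    · by_cases hr : ∃ t, r t = 0 ∧ ∀ i < t, r i ≠ 0
      · obtain ⟨t, ht, ht'⟩ := hr
        -- Agreement on t + 2 entries forces j ≥ t + 1 for a nearby (a, j), which excludes (a, t).
        refine ⟨t + 2, fun p' x' hp' h hx' => ?_⟩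
        rcases smin_near_zeroTail (b := t + 1) hp' h with ⟨h, -⟩ | ⟨a', -, rfl | ⟨j, hj, rfl⟩⟩
        · omega
        · exact lim_notMem_lpoSet r a' hx'
        · rcases hx' with ⟨hx', -⟩ | ⟨k, t', hx', h1, h2⟩
          · simp at hx'
          · obtain ⟨-, rfl⟩ := SminPoint.pt.inj hx'
            have := huniq ht ht' h1 h2
            omega
      · refine ⟨1, fun p' x' hp' h hx' => ?_⟩
        rcases smin_near_zeroTail (b := 0) hp' h with ⟨h, -⟩ | ⟨a', -, rfl | ⟨j, hj, rfl⟩⟩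
        · omega
        · exact lim_notMem_lpoSet r a' hx'
        · rcases hx' with ⟨hx', -⟩ | ⟨k, t', hx', h1, h2⟩
          · simp at hx'
          · exact hr ⟨t', h1, h2⟩
  · obtain rfl : p = oneTail (a + 1) b := hp
    exact iso _ _ (.pt a b) rfl hx

/-- The test, at stage `n`, whether the open set with name `p` intersects `lpoSet r`. -/
def lpoTest (r p : Baire) (n : ℕ) : Prop :=
  ∃ k < n + 1, ∃ t < n + 1, (∀ i < t, r i ≠ 0) ∧
    ((t = n ∧ Accepts p (zeroTail 0) k) ∨ (t < n ∧ r t = 0)) ∧ Accepts p (oneTail (k + 1) t) n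

theorem lpoTest_congr {r r' p p' : Baire} {n : ℕ} (hr : ∀ i < n, r i = r' i)
    (hp : ∀ i < n, p i = p' i) (h : lpoTest r p n) : lpoTest r' p' n := by
  obtain ⟨k, hk, t, ht, h1, h2, h3⟩ := h
  refine ⟨k, hk, t, ht, fun i hi => hr i (by omega) ▸ h1 i hi, ?_, h3.congr hp fun _ _ => rfl⟩
  rcases h2 with ⟨rfl, h2⟩ | ⟨htn, h2⟩
  · exact Or.inl ⟨rfl, h2.congr (fun i hi => hp i (by omega)) fun _ _ => rfl⟩
  · exact Or.inr ⟨htn, hr t htn ▸ h2⟩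

theorem isLocalPred_lpoTest (r : Baire) : IsLocalPred (lpoTest r) :=
  fun _ _ _ h => lpoTest_congr (fun _ _ => rfl) h

/-- The disjunct `t = n` of `lpoTest` accepts before it is known whether `r` has a zero. It is sound
because the evidence for (k, t) uses only entries that (k, t) shares with every (k, t') for t' ≥ t,
while (∞, ∞) covers the case of no zero. -/
theorem meets_lpoSet_iff (r : Baire) {p : Baire} {U : (openSets Smin).carrier}
    (hp : (openSets Smin).names p U) :
    (U.1 ∩ lpoSet r).Nonempty ↔ ∃ n, lpoTest r p n := by
  have hinf : SminPoint.inf ∈ U.1 ↔ ∃ s, Accepts p (zeroTail 0) s :=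
    mem_iff_exists_accepts hp (X := Smin) (x := .inf) rfl
  have hpt : ∀ k t, SminPoint.pt k t ∈ U.1 ↔ ∃ s, Accepts p (oneTail (k + 1) t) s := fun k t =>
    mem_iff_exists_accepts hp (X := Smin) (x := .pt k t) rfl
  constructor
  · rintro ⟨x, hxU, ⟨rfl, hr⟩ | ⟨k, t, rfl, hr, hlt⟩⟩
    · obtain ⟨k, hk⟩ := hinf.1 hxU
      -- Acceptance of 00^ω within `k` entries does not distinguish it from 00^k1^ω, a name of (k,
      -- ∞).
      have hlim : SminPoint.lim k ∈ U.1 :=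
        (mem_iff_exists_accepts hp (X := Smin) (a := oneTail 0 k) (x := .lim k) (Or.inl rfl)).2
          ⟨k, hk.congr (fun _ _ => rfl) fun i hi => by
            simp only [zeroTail, oneTail]
            rw [if_pos (by omega : i ≤ k)]⟩
      -- Change to the other name of (k, ∞), which is approximated by names of the points (k, t).
      obtain ⟨s, hs⟩ := (mem_iff_exists_accepts hp (X := Smin) (a := zeroTail (k + 1))
        (x := .lim k) (Or.inr rfl)).1 hlim
      refine ⟨k + s, k, by omega, k + s, by omega, fun i _ => hr i, Or.inl ⟨rfl, hk⟩,
        (hs.mono (by omega)).congr (fun _ _ => rfl) fun i hi => ?_⟩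
      simp only [zeroTail, oneTail]
      rw [if_pos (by omega : i ≤ k + s)]
    · obtain ⟨s, hs⟩ := (hpt k t).1 hxU
      exact ⟨s + k + t + 1, k, by omega, t, by omega, hlt, Or.inr ⟨by omega, hr⟩,
        hs.mono (by omega)⟩
  · rintro ⟨n, k, hk, t, ht, hlt, ⟨rfl, h0⟩ | ⟨htn, hr⟩, hacc⟩
    · by_cases hr : ∃ i, r i = 0
      · classical
        refine ⟨.pt k (Nat.find hr), (hpt _ _).2 ⟨t, hacc.congr (fun _ _ => rfl) fun i hi => ?_⟩,
          Or.inr ⟨_, _, rfl, Nat.find_spec hr, fun i hi => Nat.find_min hr hi⟩⟩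
        -- The first zero is not below `t`, so the names of (k, t) and of the true element of column
        -- `k` agree on the `t` entries used.
        have : t ≤ Nat.find hr := by
          by_contra hc
          exact hlt _ (not_le.1 hc) (Nat.find_spec hr)
        simp only [oneTail]
        rw [if_pos (by omega : i ≤ t), if_pos (by omega : i ≤ Nat.find hr)]
      · exact ⟨.inf, hinf.2 ⟨k, h0⟩, Or.inl ⟨rfl, fun i hi => hr ⟨i, hi⟩⟩⟩
    · exact ⟨.pt k t, (hpt k t).2 ⟨n, hacc⟩, Or.inr ⟨k, t, rfl, hr, hlt⟩⟩

theorem primrecPred_lpoTest :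
    PrimrecPred fun q : (List ℕ × List ℕ) × ℕ => lpoTest (ext q.1.1) (ext q.1.2) q.2 := by
  have hr : Primrec₂ fun (q : (((List ℕ × List ℕ) × ℕ) × ℕ) × ℕ) => ext q.1.1.1.1 :=
    primrec_ext.comp₂ (Primrec.fst.comp
      (Primrec.fst.comp (Primrec.fst.comp (Primrec.fst.comp .fst)))).to₂ .right
  have hp : Primrec₂ fun (q : (((List ℕ × List ℕ) × ℕ) × ℕ) × ℕ) => ext q.1.1.1.2 :=
    primrec_ext.comp₂ (Primrec.snd.comp
      (Primrec.fst.comp (Primrec.fst.comp (Primrec.fst.comp .fst)))).to₂ .right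
  have hn : Primrec fun q : (((List ℕ × List ℕ) × ℕ) × ℕ) × ℕ => q.1.1.2 :=
    Primrec.snd.comp (Primrec.fst.comp .fst)
  have hk : Primrec fun q : (((List ℕ × List ℕ) × ℕ) × ℕ) × ℕ => q.1.2 :=
    Primrec.snd.comp .fst
  refine primrecPred_exists_lt (PrimrecPred.primrecRel (p := fun q : ((List ℕ × List ℕ) × ℕ) × ℕ =>
    ∃ t < q.1.2 + 1, (∀ i < t, ext q.1.1.1 i ≠ 0) ∧
      ((t = q.1.2 ∧ Accepts (ext q.1.1.2) (zeroTail 0) q.2) ∨ (t < q.1.2 ∧ ext q.1.1.1 t = 0)) ∧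
      Accepts (ext q.1.1.2) (oneTail (q.2 + 1) t) q.1.2) ?_) (Primrec.succ.comp .snd)
  refine primrecPred_exists_lt (PrimrecPred.primrecRel
    (p := fun q : (((List ℕ × List ℕ) × ℕ) × ℕ) × ℕ =>
      (∀ i < q.2, ext q.1.1.1.1 i ≠ 0) ∧
      ((q.2 = q.1.1.2 ∧ Accepts (ext q.1.1.1.2) (zeroTail 0) q.1.2) ∨
        (q.2 < q.1.1.2 ∧ ext q.1.1.1.1 q.2 = 0)) ∧
      Accepts (ext q.1.1.1.2) (oneTail (q.1.2 + 1) q.2) q.1.1.2) ?_)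
    (Primrec.succ.comp (Primrec.snd.comp .fst))
  refine PrimrecPred.and (primrecPred_forall_lt (PrimrecPred.primrecRel
    (p := fun q : ((((List ℕ × List ℕ) × ℕ) × ℕ) × ℕ) × ℕ => ext q.1.1.1.1.1 q.2 ≠ 0)
    (PrimrecPred.not (Primrec.eq.comp (hr.comp .fst .snd) (.const 0)))) .snd)
    (PrimrecPred.and (PrimrecPred.or (PrimrecPred.and (Primrec.eq.comp .snd hn) ?_)
      (PrimrecPred.and (Primrec.nat_lt.comp .snd hn)
        (Primrec.eq.comp (hr.comp .id .snd) (.const 0)))) ?_)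
  · exact primrecPred_accepts hp (primrec_zeroTail (.const 0) .snd) hk
  · exact primrecPred_accepts hp
      (primrec_oneTail (Primrec.succ.comp (hk.comp .fst)) (Primrec.snd.comp .fst) .snd) hn

theorem computableFun_staged_lpoTest :
    ComputableFun ((fun r => staged (lpoTest r) : Baire → Baire) : Baire →. Baire) := by
  refine computableFun_coe (fun r r' c h => ?_) ?_
  · simp only [staged, assoc]
    rcases hc : (decode c : Option (ℕ × List ℕ)) with _ | ⟨n, w⟩
    · rfl
    · have hcn : n ≤ c := by
        have h1 : encode (n, w) = c := by
          have := Denumerable.encode_ofNat (α := ℕ × List ℕ) c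
          rw [Denumerable.decode_eq_ofNat] at hc
          rw [← Option.some.inj hc, this]
        rw [← h1]
        exact Nat.left_le_pair _ _
      have : lpoTest r (ext w) n ↔ lpoTest r' (ext w) n :=
        ⟨lpoTest_congr (fun i hi => h i (by omega)) fun _ _ => rfl,
          lpoTest_congr (fun i hi => (h i (by omega)).symm) fun _ _ => rfl⟩
      dsimp only
      split_ifs <;> tauto
  · exact primrec_staged (primrecPred_lpoTest.comp
      ((Primrec.fst.pair (Primrec.snd.comp .snd)).pair (Primrec.fst.comp .snd)))

theorem LPO_le_VC : WeihrauchLE LPO (VC Smin) := by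
  classical
  -- Entry 1 of the pair is the first entry of the chosen name: 0 for (∞, ∞) and k + 1 for (k, t).
  -- The set contains no (a, ∞), whose two names would be ambiguous here.
  let K : Baire → Baire := fun x _ => if x 1 = 0 then 0 else 1
  have hK : ComputableFun (K : Baire →. Baire) := by
    refine computableFun_coe (fun x x' n h => ?_) ?_
    · simp only [K, h 1 (by omega)]
    · exact Primrec.ite (Primrec.eq.comp (primrec_ext.comp .fst (.const 1)) (.const 0))
        (.const 0) (.const 1)
  refine ⟨_, _, computableFun_staged_lpoTest, hK, fun G hG r r' hr _ => ?_⟩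
  obtain rfl : r = r' := hr
  let A : (overtSets Smin).carrier := ⟨lpoSet r, isOpenIn_compl_lpoSet r⟩
  have hA : (overtSets Smin).names (staged (lpoTest r)) A :=
    staged_names (X := openSets Smin) (isLocalPred_lpoTest r)
      fun p U hp => meets_lpoSet_iff r hp
  have hne : (VC Smin A).Nonempty := by
    by_cases h : ∃ i, r i = 0
    · exact ⟨.pt 0 (Nat.find h),
        Or.inr ⟨_, _, rfl, Nat.find_spec h, fun i hi => Nat.find_min h hi⟩⟩
    · exact ⟨.inf, Or.inl ⟨rfl, fun i hi => h ⟨i, hi⟩⟩⟩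
  obtain ⟨q, hq, x, hqx, hx⟩ := hG _ A hA hne
  refine ⟨K (pair r q), ?_, (if ∃ k, r k = 0 then 1 else 0 : Fin 2), ?_, ?_⟩
  · simp only [Part.mem_bind_iff]
    exact ⟨_, by simp, q, hq, by simp⟩
  · have hpair : pair r q 1 = q 0 := by simp [pair]
    change (if pair r q 1 = 0 then 0 else 1 : ℕ) = ((if ∃ k, r k = 0 then 1 else 0 : Fin 2) : ℕ)
    rw [hpair]
    rcases hx with ⟨rfl, hr⟩ | ⟨k, t, rfl, hr, -⟩
    · obtain rfl : q = zeroTail 0 := hqx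
      rw [if_pos (by simp [zeroTail]), if_neg fun ⟨k, hk⟩ => hr k hk]
      rfl
    · obtain rfl : q = oneTail (k + 1) t := hqx
      rw [if_neg (by simp [oneTail]), if_pos ⟨t, hr⟩]
      rfl
  · simp only [LPO, single]
    exact Set.mem_singleton_iff.2 (by congr)

/-! ### Overt choice on `S_min` is reducible to `LPO` -/

/-- The test for the open set `{(a, b)}`. -/
def ptTest (a b : ℕ) (x : Baire) (s : ℕ) : Prop :=
  b + 2 ≤ s ∧ ∀ i < b + 2, x i = oneTail (a + 1) b i

/-- The test for the open set `{(a, ∞)} ∪ {(a, j) | j ∈ ℕ}`. -/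
def limTest (a : ℕ) (x : Baire) (s : ℕ) : Prop :=
  (0 < s ∧ x 0 = a + 1) ∨ (a + 2 ≤ s ∧ ∀ i < a + 2, x i = oneTail 0 a i)

/-- The test for the open set `{(∞, ∞)} ∪ {(i, ∞) | i ≥ m} ∪ {(i, j) | i ≥ m, j ∈ ℕ}`. -/
def infTest (m : ℕ) (x : Baire) (s : ℕ) : Prop :=
  (0 < s ∧ m < x 0) ∨ (m + 1 ≤ s ∧ ∀ i < m + 1, x i = 0)

theorem isLocalPred_ptTest (a b : ℕ) : IsLocalPred (ptTest a b) := fun _ _ _ h hx =>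
  ⟨hx.1, fun i hi => h i (hi.trans_le hx.1) ▸ hx.2 i hi⟩

theorem isLocalPred_limTest (a : ℕ) : IsLocalPred (limTest a) := fun _ _ _ h hx => by
  obtain ⟨hs, hx⟩ | ⟨hs, hx⟩ := hx
  · exact Or.inl ⟨hs, h 0 hs ▸ hx⟩
  · exact Or.inr ⟨hs, fun i hi => h i (hi.trans_le hs) ▸ hx i hi⟩

theorem isLocalPred_infTest (m : ℕ) : IsLocalPred (infTest m) := fun _ _ _ h hx => by
  obtain ⟨hs, hx⟩ | ⟨hs, hx⟩ := hx
  · exact Or.inl ⟨hs, h 0 hs ▸ hx⟩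
  · exact Or.inr ⟨hs, fun i hi => h i (hi.trans_le hs) ▸ hx i hi⟩

/-- The open neighbourhood of `(a, ∞)` tested by `limTest a`. -/
def limSet (a : ℕ) : Set SminPoint := {x | x = .lim a ∨ ∃ j, x = .pt a j}

/-- The open neighbourhood of `(∞, ∞)` tested by `infTest m`. -/
def infSet (m : ℕ) : Set SminPoint :=
  {x | x = .inf ∨ (∃ a ≥ m, x = .lim a) ∨ ∃ a ≥ m, ∃ j, x = .pt a j}

theorem forall_oneTail_eq_iff {i j c b : ℕ} :
    (∀ k < b + 2, oneTail i j k = oneTail c b k) ↔ i = c ∧ j = b := by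
  refine ⟨fun h => ⟨by simpa [oneTail] using h 0 (by omega), ?_⟩, fun h k _ => by rw [h.1, h.2]⟩
  rcases lt_trichotomy j b with hj | hj | hj
  · have := h (j + 1) (by omega)
    simp [oneTail, Nat.succ_le_of_lt hj] at this
  · exact hj
  · have := h (b + 1) (by omega)
    simp [oneTail, Nat.succ_le_of_lt hj] at this

theorem not_forall_zeroTail_eq {i c b : ℕ} :
    ¬ ∀ k < b + 2, zeroTail i k = oneTail c b k := fun h => by
  have := h (b + 1) (by omega)
  simp [oneTail, zeroTail] at this

theorem exists_ptTest_iff {a b : ℕ} {p : Baire} :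
    (∃ s, ptTest a b p s) ↔ ∀ i < b + 2, p i = oneTail (a + 1) b i :=
  ⟨fun ⟨_, _, h⟩ => h, fun h => ⟨b + 2, le_rfl, h⟩⟩

theorem exists_limTest_iff {a : ℕ} {p : Baire} :
    (∃ s, limTest a p s) ↔ p 0 = a + 1 ∨ ∀ i < a + 2, p i = oneTail 0 a i :=
  ⟨fun ⟨_, h⟩ => h.imp And.right And.right, fun h => ⟨a + 2, h.imp (fun h => ⟨by omega, h⟩)
    fun h => ⟨le_rfl, h⟩⟩⟩

theorem exists_infTest_iff {m : ℕ} {p : Baire} :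
    (∃ s, infTest m p s) ↔ m < p 0 ∨ ∀ i < m + 1, p i = 0 :=
  ⟨fun ⟨_, h⟩ => h.imp And.right And.right, fun h => ⟨m + 1, h.imp (fun h => ⟨by omega, h⟩)
    fun h => ⟨le_rfl, h⟩⟩⟩

theorem mem_pt_iff (a b : ℕ) (p : Baire) (x : SminPoint) (hp : SminNames p x) :
    x ∈ ({.pt a b} : Set SminPoint) ↔ ∃ s, ptTest a b p s := by
  rw [exists_ptTest_iff]
  rcases x with _ | c | ⟨c, d⟩
  · obtain rfl : p = zeroTail 0 := hp
    simpa using not_forall_zeroTail_eq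
  · rcases hp with rfl | rfl
    · simp [forall_oneTail_eq_iff]
    · simpa using not_forall_zeroTail_eq
  · obtain rfl : p = oneTail (c + 1) d := hp
    simp [forall_oneTail_eq_iff]

/-- A first entry a + 1 covers column a together with the name (a+1)0^ω of its limit; the second
clause of `limTest` recognises the remaining name 00^a1^ω. -/
theorem mem_limSet_iff (a : ℕ) (p : Baire) (x : SminPoint) (hp : SminNames p x) :
    x ∈ limSet a ↔ ∃ s, limTest a p s := by
  rw [exists_limTest_iff]
  rcases x with _ | c | ⟨c, d⟩
  · obtain rfl : p = zeroTail 0 := hp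
    have := not_forall_zeroTail_eq (i := 0) (c := 0) (b := a)
    simp only [this, or_false]
    simp [limSet, zeroTail]
  · rcases hp with rfl | rfl
    · rw [forall_oneTail_eq_iff]
      simp [limSet, oneTail]
    · have := not_forall_zeroTail_eq (i := c + 1) (c := 0) (b := a)
      simp only [this, or_false]
      simp [limSet, zeroTail]
  · obtain rfl : p = oneTail (c + 1) d := hp
    rw [forall_oneTail_eq_iff]
    simp [limSet, oneTail]

/-- A first entry above m means column at least m; m + 1 leading zeros leave exactly 00^ω and the
names 00^c1^ω with c ≥ m. -/
theorem mem_infSet_iff (m : ℕ) (p : Baire) (x : SminPoint) (hp : SminNames p x) :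
    x ∈ infSet m ↔ ∃ s, infTest m p s := by
  rw [exists_infTest_iff]
  rcases x with _ | c | ⟨c, d⟩
  · obtain rfl : p = zeroTail 0 := hp
    simp [infSet, zeroTail]
  · have hmem : SminPoint.lim c ∈ infSet m ↔ m ≤ c := by simp [infSet]
    rw [hmem]
    rcases hp with rfl | rfl
    · constructor
      · intro h
        refine Or.inr fun i hi => ?_
        simp only [oneTail]
        rw [if_pos (by omega : i ≤ c), ite_self]
      · rintro (h | h)
        · simp [oneTail] at h
        · by_contra hc
          have := h (c + 1) (by omega)
          simp [oneTail] at this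
    · constructor
      · intro h
        exact Or.inl (by simpa [zeroTail] using Nat.lt_succ_of_le h)
      · rintro (h | h)
        · simp [zeroTail] at h
          omega
        · simpa [zeroTail] using h 0 (by omega)
  · obtain rfl : p = oneTail (c + 1) d := hp
    have hmem : SminPoint.pt c d ∈ infSet m ↔ m ≤ c := by simp [infSet]
    rw [hmem]
    constructor
    · intro h
      exact Or.inl (by simpa [oneTail] using Nat.lt_succ_of_le h)
    · rintro (h | h)
      · simp [oneTail] at h
        omega
      · simpa [oneTail] using h 0 (by omega)

/-- Intersection of a named overt set with an open set given by a test is detected at some stage. -/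
theorem meets_iff_exists_accepts {X : RepSpace} {P : Baire} {A : (overtSets X).carrier}
    (hP : (overtSets X).names P A) {T : Baire → ℕ → Prop} (hT : IsLocalPred T) {U : Set X.carrier}
    (hU : ∀ a x, X.names a x → (x ∈ U ↔ ∃ n, T a n)) :
    (U ∩ A.1).Nonempty ↔ ∃ s, Accepts P (staged T) s :=
  mem_iff_exists_accepts (X := openSets X) hP
    (x := ⟨U, isOpenIn_of_isLocalPred hT hU⟩) (staged_names hT hU)

/-! #### The isolated points -/

/-- The first coordinate of the point checked at stage `c`. -/
def ptFst (c : ℕ) : ℕ := c.unpair.1.unpair.1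

/-- The second coordinate of the point checked at stage `c`. -/
def ptSnd (c : ℕ) : ℕ := c.unpair.1.unpair.2

/-- The overt set named by `P` is seen to contain the point checked at stage `c`. -/
def PtHit (P : Baire) (c : ℕ) : Prop := Accepts P (staged (ptTest (ptFst c) (ptSnd c))) c

/-- `c` is the first stage at which a point is seen to be contained in the set named by `P`. -/
def PtFirst (P : Baire) (c : ℕ) : Prop := PtHit P c ∧ ∀ j < c, ¬ PtHit P j

theorem ptHit_congr {P P' : Baire} {c : ℕ} (h : ∀ i < c, P i = P' i) : PtHit P c ↔ PtHit P' c :=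
  accepts_congr h fun _ _ => rfl

theorem ptFirst_congr {P P' : Baire} {c : ℕ} (h : ∀ i < c, P i = P' i) :
    PtFirst P c ↔ PtFirst P' c :=
  and_congr (ptHit_congr h) (forall₂_congr fun _ hj =>
    not_congr (ptHit_congr fun i hi => h i (hi.trans hj)))

theorem PtFirst.unique {P : Baire} {c c' : ℕ} (h : PtFirst P c) (h' : PtFirst P c') : c = c' := by
  rcases lt_trichotomy c c' with hc | hc | hc
  · exact absurd h.1 (h'.2 c hc)
  · exact hc
  · exact absurd h'.1 (h.2 c' hc)

theorem exists_ptHit_iff {P : Baire} {A : (overtSets Smin).carrier}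
    (hP : (overtSets Smin).names P A) :
    (∃ c, PtHit P c) ↔ ∃ a b, SminPoint.pt a b ∈ A.1 := by
  have key : ∀ a b, SminPoint.pt a b ∈ A.1 ↔ ∃ s, Accepts P (staged (ptTest a b)) s :=
    fun a b => Set.singleton_inter_nonempty.symm.trans
      (meets_iff_exists_accepts hP (isLocalPred_ptTest a b) (mem_pt_iff a b))
  constructor
  · rintro ⟨c, hc⟩
    exact ⟨_, _, (key _ _).2 ⟨c, hc⟩⟩
  · rintro ⟨a, b, h⟩
    obtain ⟨s, hs⟩ := (key a b).1 h
    -- The code is at least `s`, so by monotonicity it can serve as the stage bound as well.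
    refine ⟨Nat.pair (Nat.pair a b) s, ?_⟩
    simp only [PtHit, ptFst, ptSnd, Nat.unpair_pair]
    exact hs.mono (Nat.right_le_pair _ _)

theorem PtHit.mem {P : Baire} {A : (overtSets Smin).carrier} (hP : (overtSets Smin).names P A)
    {c : ℕ} (h : PtHit P c) : SminPoint.pt (ptFst c) (ptSnd c) ∈ A.1 :=
  Set.singleton_inter_nonempty.1
    ((meets_iff_exists_accepts hP (isLocalPred_ptTest _ _) (mem_pt_iff _ _)).2 ⟨c, h⟩)

open Classical in
/-- The associate value that describes the first point seen up to stage `h`. -/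
noncomputable def ptValue (P : Baire) (h n : ℕ) : ℕ :=
  if ∃ c < h + 1, PtFirst P c then
    oneTail (ptFst (Nat.findGreatest (PtFirst P) h) + 1) (ptSnd (Nat.findGreatest (PtFirst P) h)) n + 1
  else 0

/-- Since a first hit is unique, the greatest first hit up to `h` is the first hit. The bounded
search `Nat.findGreatest` keeps the value primitive recursive. -/
theorem PtFirst.ptValue {P : Baire} {c : ℕ} (hc : PtFirst P c) (h n : ℕ) :
    ptValue P h n = if c < h + 1 then oneTail (ptFst c + 1) (ptSnd c) n + 1 else 0 := by
  classical
  unfold OvertChoice.ptValue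
  by_cases hch : c < h + 1
  · have hg : Nat.findGreatest (PtFirst P) h = c :=
      (Nat.findGreatest_spec (P := PtFirst P) (Nat.lt_succ_iff.1 hch) hc).unique hc
    rw [if_pos ⟨c, hch, hc⟩, if_pos hch, hg]
  · rw [if_neg hch, if_neg]
    rintro ⟨c', hc', h'⟩
    exact hch (h'.unique hc ▸ hc')

theorem ptValue_congr {P P' : Baire} {h : ℕ} (hPP : ∀ i < h, P i = P' i) (n : ℕ) :
    ptValue P h n = ptValue P' h n := by
  by_cases hex : ∃ c < h + 1, PtFirst P c
  · obtain ⟨c, hch, hc⟩ := hex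
    have hc' : PtFirst P' c := (ptFirst_congr fun i hi => hPP i (by omega)).1 hc
    rw [hc.ptValue, hc'.ptValue]
  · have hex' : ¬ ∃ c < h + 1, PtFirst P' c := fun ⟨c, hch, hc⟩ =>
      hex ⟨c, hch, (ptFirst_congr fun i hi => hPP i (by omega)).2 hc⟩
    rw [ptValue, ptValue, if_neg hex, if_neg hex']

/-! #### The limit points -/

/-- It is seen at stage `t` that the set with name `P` meets `infSet (i + 1)`, and not yet that it
meets `limSet i`. -/
def ZeroAt (P : Baire) (i t : ℕ) : Prop :=
  Accepts P (staged (infTest (i + 1))) t ∧ ¬ Accepts P (staged (limTest i)) t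

/-- It is seen at stage `t` that the set with name `P` meets `limSet i`, and not before that it
meets `infSet (i + 1)`. -/
def OneAt (P : Baire) (i t : ℕ) : Prop :=
  Accepts P (staged (limTest i)) t ∧ ∀ u < t, ¬ ZeroAt P i u

theorem zeroAt_congr {P P' : Baire} {i t : ℕ} (h : ∀ k < t, P k = P' k) :
    ZeroAt P i t ↔ ZeroAt P' i t :=
  and_congr (accepts_congr h fun _ _ => rfl) (not_congr (accepts_congr h fun _ _ => rfl))

theorem oneAt_congr {P P' : Baire} {i t : ℕ} (h : ∀ k < t, P k = P' k) :
    OneAt P i t ↔ OneAt P' i t :=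
  and_congr (accepts_congr h fun _ _ => rfl) (forall₂_congr fun _ hu =>
    not_congr (zeroAt_congr fun k hk => h k (hk.trans hu)))

/-- Ties go to `limTest`, and its acceptance persists, so a race never has two different outcomes.
-/
theorem OneAt.not_zeroAt {P : Baire} {i t : ℕ} (h : OneAt P i t) (u : ℕ) : ¬ ZeroAt P i u :=
  fun hz => (lt_or_ge u t).elim (fun hu => h.2 u hu hz) fun hu => hz.2 (h.1.mono hu)

theorem exists_oneAt {P : Baire} {i t : ℕ} (h : Accepts P (staged (limTest i)) t)
    (hz : ∀ u, ¬ ZeroAt P i u) : ∃ t, OneAt P i t :=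
  ⟨t, h, fun u _ => hz u⟩

theorem zeroAt_or_oneAt {P : Baire} {i t : ℕ} (h : Accepts P (staged (limTest i)) t ∨
    Accepts P (staged (infTest (i + 1))) t) : (∃ u, ZeroAt P i u) ∨ ∃ u, OneAt P i u := by
  by_cases hz : ∃ u, ZeroAt P i u
  · exact Or.inl hz
  · push Not at hz
    by_cases hl : Accepts P (staged (limTest i)) t
    · exact Or.inr (exists_oneAt hl hz)
    · exact absurd ⟨h.resolve_left hl, hl⟩ (hz t)

open Classical in
/-- The associate value, at stage `h`, of a name `0 0^j 1^ω` or `0 0^ω` of a limit point. -/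
noncomputable def limValue (P : Baire) (h n : ℕ) : ℕ :=
  if ∀ i < n, ∃ t < h, ZeroAt P i t then 1
  else if ∃ j < n, (∃ t < h, OneAt P j t) ∧ ∀ i < j, ∃ t < h, ZeroAt P i t then 2
  else 0

theorem limValue_congr {P P' : Baire} {h : ℕ} (hPP : ∀ i < h, P i = P' i) (n : ℕ) :
    limValue P h n = limValue P' h n := by
  have hz : ∀ i, (∃ t < h, ZeroAt P i t) ↔ ∃ t < h, ZeroAt P' i t := fun i =>
    exists_congr fun t => and_congr_right fun ht => zeroAt_congr fun k hk => hPP k (hk.trans ht)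
  have ho : ∀ i, (∃ t < h, OneAt P i t) ↔ ∃ t < h, OneAt P' i t := fun i =>
    exists_congr fun t => and_congr_right fun ht => oneAt_congr fun k hk => hPP k (hk.trans ht)
  classical
  exact if_congr (by simp only [hz]) rfl (if_congr (by simp only [hz, ho]) rfl rfl)

theorem exists_bound_zeroAt {P : Baire} {n : ℕ} (hz : ∀ i < n, ∃ t, ZeroAt P i t) :
    ∃ h, ∀ i < n, ∃ t < h, ZeroAt P i t := by
  induction n with
  | zero => exact ⟨0, by simp⟩
  | succ n ih =>
    obtain ⟨h, hh⟩ := ih fun i hi => hz i (by omega)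
    obtain ⟨t, ht⟩ := hz n (by omega)
    refine ⟨max h (t + 1), fun i hi => ?_⟩
    rcases Nat.lt_succ_iff_lt_or_eq.1 hi with hi | rfl
    · obtain ⟨u, hu, hu'⟩ := hh i hi
      exact ⟨u, lt_max_of_lt_left hu, hu'⟩
    · exact ⟨t, lt_max_of_lt_right (Nat.lt_succ_self t), ht⟩

/-- Entry `n` depends on the races `i < n` only; for n = 0 the condition is vacuous and gives the
leading 0 of the name. -/
theorem limValue_of_forall_zeroAt {P : Baire} (hz : ∀ i, ∃ t, ZeroAt P i t) (n : ℕ) :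
    (∃ h, ∀ h' ≥ h, limValue P h' n ≠ 0) ∧
      ∀ h, limValue P h n = 0 ∨ limValue P h n = zeroTail 0 n + 1 := by
  have h0 : zeroTail 0 n = 0 := by simp [zeroTail]
  refine ⟨?_, fun h => ?_⟩
  · obtain ⟨h, hh⟩ := exists_bound_zeroAt (n := n) fun i _ => hz i
    refine ⟨h, fun h' hh' => ?_⟩
    rw [limValue, if_pos fun i hi => (hh i hi).imp fun t ht => ⟨ht.1.trans_le hh', ht.2⟩]
    simp
  · rw [h0, limValue]
    split_ifs with h1 h2
    · simp
    · obtain ⟨j, -, ⟨t, -, ht⟩, -⟩ := h2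
      obtain ⟨u, hu⟩ := hz j
      exact absurd hu (ht.not_zeroAt u)
    · simp

theorem limValue_of_oneAt {P : Baire} {j t : ℕ} (hz : ∀ i < j, ∃ t, ZeroAt P i t)
    (ho : OneAt P j t) (n : ℕ) :
    (∃ h, ∀ h' ≥ h, limValue P h' n ≠ 0) ∧
      ∀ h, limValue P h n = 0 ∨ limValue P h n = oneTail 0 j n + 1 := by
  by_cases hn : n ≤ j
  · have h0 : oneTail 0 j n = 0 := by simp [oneTail, hn]
    refine ⟨?_, fun h => ?_⟩
    · obtain ⟨h, hh⟩ := exists_bound_zeroAt (n := n) fun i hi => hz i (by omega)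
      refine ⟨h, fun h' hh' => ?_⟩
      rw [limValue, if_pos fun i hi => (hh i hi).imp fun t ht => ⟨ht.1.trans_le hh', ht.2⟩]
      simp
    · rw [h0, limValue]
      split_ifs with h1 h2
      · simp
      · obtain ⟨k, hk, ⟨t, -, ht⟩, -⟩ := h2
        obtain ⟨u, hu⟩ := hz k (by omega)
        exact absurd hu (ht.not_zeroAt u)
      · simp
  · have h0 : oneTail 0 j n = 1 := by
      simp only [oneTail]
      rw [if_neg (by omega), if_neg hn]
    -- Beyond position `j` the entry can no longer become 0, since race `j` was decided the other
    -- way.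
    have hneg : ∀ h, ¬ ∀ i < n, ∃ t < h, ZeroAt P i t := fun h hall => by
      obtain ⟨u, -, hu⟩ := hall j (by omega)
      exact ho.not_zeroAt u hu
    refine ⟨?_, fun h => ?_⟩
    · obtain ⟨h, hh⟩ := exists_bound_zeroAt hz
      refine ⟨max h (t + 1), fun h' hh' => ?_⟩
      rw [limValue, if_neg (hneg h'), if_pos]
      · simp
      · exact ⟨j, by omega, ⟨t, (lt_max_of_lt_right (Nat.lt_succ_self t)).trans_le hh', ho⟩,
          fun i hi => (hh i hi).imp fun u hu =>
            ⟨(lt_max_of_lt_left hu.1).trans_le hh', hu.2⟩⟩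
    · rw [h0, limValue, if_neg (hneg h)]
      split_ifs <;> simp

/-- If the set named by `P` has no isolated points, one of its elements is found. -/
theorem exists_limValue {P : Baire} {A : (overtSets Smin).carrier}
    (hP : (overtSets Smin).names P A) (hne : A.1.Nonempty)
    (hA : ∀ a b, SminPoint.pt a b ∉ A.1) :
    ∃ y x, SminNames y x ∧ x ∈ A.1 ∧ ∀ n, (∃ h, ∀ h' ≥ h, limValue P h' n ≠ 0) ∧
      ∀ h, limValue P h n = 0 ∨ limValue P h n = y n + 1 := by
  classical
  -- Without isolated points in `A`, meeting the neighbourhood of (i, ∞) is the same as containing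
  -- (i, ∞).
  have hlim : ∀ i, SminPoint.lim i ∈ A.1 ↔ ∃ s, Accepts P (staged (limTest i)) s := fun i => by
    rw [← meets_iff_exists_accepts hP (isLocalPred_limTest i) (mem_limSet_iff i)]
    constructor
    · exact fun h => ⟨_, Or.inl rfl, h⟩
    · rintro ⟨x, rfl | ⟨j, rfl⟩, hx⟩
      · exact hx
      · exact absurd hx (hA _ _)
  have hinf : ∀ m, (∃ s, Accepts P (staged (infTest m)) s) ↔
      SminPoint.inf ∈ A.1 ∨ ∃ a ≥ m, SminPoint.lim a ∈ A.1 := fun m => by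
    rw [← meets_iff_exists_accepts hP (isLocalPred_infTest m) (mem_infSet_iff m)]
    constructor
    · rintro ⟨x, rfl | ⟨a, ha, rfl⟩ | ⟨a, -, j, rfl⟩, hx⟩
      · exact Or.inl hx
      · exact Or.inr ⟨a, ha, hx⟩
      · exact absurd hx (hA _ _)
    · rintro (h | ⟨a, ha, h⟩)
      · exact ⟨_, Or.inl rfl, h⟩
      · exact ⟨_, Or.inr (Or.inl ⟨a, ha, rfl⟩), h⟩
  -- Invariant of the races: while only zeros have been written, `A` still has an element in the
  -- tail from `n` on. The last race alone shows this.
  have hstep : ∀ n, (∀ i < n, ∃ t, ZeroAt P i t) →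
      SminPoint.inf ∈ A.1 ∨ ∃ a ≥ n, SminPoint.lim a ∈ A.1 := fun n hn => by
    rcases n with _ | n
    · obtain ⟨x, hx⟩ := hne
      rcases x with _ | a | ⟨a, b⟩
      · exact Or.inl hx
      · exact Or.inr ⟨a, Nat.zero_le _, hx⟩
      · exact absurd hx (hA _ _)
    · obtain ⟨t, ht⟩ := hn n (by omega)
      exact (hinf _).1 ⟨t, ht.1⟩
  by_cases hz : ∀ i, ∃ t, ZeroAt P i t
  · refine ⟨zeroTail 0, .inf, rfl, ?_, limValue_of_forall_zeroAt hz⟩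
    by_contra hc
    -- If (∞, ∞) were outside the closed set `A`, so would be all (a, ∞) with a ≥ m, contrary to the
    -- invariant at `m`.
    obtain ⟨m, hm⟩ := A.2.names (p := zeroTail 0) (x := .inf) rfl hc
    obtain h | ⟨a, ha, h⟩ := hstep m fun i _ => hz i
    · exact hc h
    · refine hm (oneTail 0 a) (.lim a) (Or.inl rfl) (fun i hi => ?_) h
      simp only [zeroTail, oneTail]
      rw [if_pos (by omega : i ≤ a)]
  · have hex : ∃ i, ¬ ∃ t, ZeroAt P i t := not_forall.1 hz
    obtain ⟨j, hj, hmin⟩ : ∃ j, (¬ ∃ t, ZeroAt P j t) ∧ ∀ i < j, ∃ t, ZeroAt P i t :=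
      ⟨Nat.find hex, Nat.find_spec hex, fun i hi => not_not.1 (Nat.find_min hex hi)⟩
    -- By the invariant at `j`, `A` contains (j, ∞) or meets the tail beyond `j`, so race `j` ends;
    -- it is not decided for 0, hence for 1.
    have hacc : ∃ t, Accepts P (staged (limTest j)) t ∨ Accepts P (staged (infTest (j + 1))) t := by
      obtain h | ⟨a, ha, h⟩ := hstep j hmin
      · obtain ⟨s, hs⟩ := (hinf (j + 1)).2 (Or.inl h)
        exact ⟨s, Or.inr hs⟩
      · rcases Nat.eq_or_lt_of_le ha with rfl | ha
        · obtain ⟨s, hs⟩ := (hlim _).1 h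
          exact ⟨s, Or.inl hs⟩
        · obtain ⟨s, hs⟩ := (hinf (j + 1)).2 (Or.inr ⟨a, ha, h⟩)
          exact ⟨s, Or.inr hs⟩
    obtain ⟨t, ht⟩ := hacc
    obtain ⟨u, hu⟩ := (zeroAt_or_oneAt ht).resolve_left hj
    exact ⟨oneTail 0 j, .lim j, Or.inl rfl, (hlim j).2 ⟨u, hu.1⟩, limValue_of_oneAt hmin hu⟩

/-! #### Primitive recursiveness of the tests -/

section Primrec

variable {α : Type*} [Primcodable α]

theorem primrecPred_eq_oneTail {f : α → ℕ → ℕ} {i b m : α → ℕ} (hf : Primrec₂ f) (hi : Primrec i)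
    (hb : Primrec b) (hm : Primrec m) :
    PrimrecPred fun a => ∀ k < m a, f a k = oneTail (i a) (b a) k :=
  primrecPred_forall_lt (Primrec.eq.comp hf
    (primrec_oneTail (hi.comp .fst) (hb.comp .fst) .snd)) hm

theorem primrec_staged_ptTest {i b : α → ℕ} (hi : Primrec i) (hb : Primrec b) :
    Primrec₂ fun a => staged (ptTest (i a) (b a)) := by
  have hb2 : Primrec fun q : α × (ℕ × List ℕ) => b q.1 + 2 :=
    Primrec.nat_add.comp (hb.comp .fst) (.const 2)
  refine primrec_staged (PrimrecPred.and
    (Primrec.nat_le.comp hb2 (Primrec.fst.comp .snd)) ?_)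
  exact primrecPred_eq_oneTail
    (primrec_ext.comp₂ (Primrec.snd.comp (Primrec.snd.comp .fst)).to₂ .right)
    (Primrec.succ.comp (hi.comp .fst)) (hb.comp .fst) hb2

theorem primrec_staged_limTest {i : α → ℕ} (hi : Primrec i) :
    Primrec₂ fun a => staged (limTest (i a)) := by
  have hi2 : Primrec fun q : α × (ℕ × List ℕ) => i q.1 + 2 :=
    Primrec.nat_add.comp (hi.comp .fst) (.const 2)
  have hs : Primrec fun q : α × (ℕ × List ℕ) => q.2.1 := Primrec.fst.comp .snd
  refine primrec_staged (PrimrecPred.or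
    (PrimrecPred.and (Primrec.nat_lt.comp (.const 0) hs) (Primrec.eq.comp
      (primrec_ext.comp (Primrec.snd.comp .snd) (.const 0)) (Primrec.succ.comp (hi.comp .fst))))
    (PrimrecPred.and (Primrec.nat_le.comp hi2 hs) ?_))
  exact primrecPred_eq_oneTail
    (primrec_ext.comp₂ (Primrec.snd.comp (Primrec.snd.comp .fst)).to₂ .right)
    (.const 0) (hi.comp .fst) hi2

theorem primrec_staged_infTest {i : α → ℕ} (hi : Primrec i) :
    Primrec₂ fun a => staged (infTest (i a)) := by
  have hi1 : Primrec fun q : α × (ℕ × List ℕ) => i q.1 + 1 := Primrec.succ.comp (hi.comp .fst)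
  have hs : Primrec fun q : α × (ℕ × List ℕ) => q.2.1 := Primrec.fst.comp .snd
  refine primrec_staged (PrimrecPred.or
    (PrimrecPred.and (Primrec.nat_lt.comp (.const 0) hs) (Primrec.nat_lt.comp (hi.comp .fst)
      (primrec_ext.comp (Primrec.snd.comp .snd) (.const 0))))
    (PrimrecPred.and (Primrec.nat_le.comp hi1 hs) (primrecPred_forall_lt ?_ hi1)))
  exact Primrec.eq.comp (primrec_ext.comp (Primrec.snd.comp (Primrec.snd.comp .fst)) .snd)
    (.const 0)

theorem primrec_ptFst : Primrec ptFst :=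
  Primrec.fst.comp (Primrec.unpair.comp (Primrec.fst.comp Primrec.unpair))

theorem primrec_ptSnd : Primrec ptSnd :=
  Primrec.snd.comp (Primrec.unpair.comp (Primrec.fst.comp Primrec.unpair))

theorem primrecPred_ptHit {f : α → ℕ → ℕ} {c : α → ℕ} (hf : Primrec₂ f) (hc : Primrec c) :
    PrimrecPred fun a => PtHit (f a) (c a) :=
  primrecPred_accepts hf
    (primrec_staged_ptTest (primrec_ptFst.comp hc) (primrec_ptSnd.comp hc)) hc

theorem primrecPred_ptFirst {f : α → ℕ → ℕ} {c : α → ℕ} (hf : Primrec₂ f) (hc : Primrec c) :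
    PrimrecPred fun a => PtFirst (f a) (c a) :=
  PrimrecPred.and (primrecPred_ptHit hf hc) (primrecPred_forall_lt
    (R := fun a j => ¬ PtHit (f a) j) (PrimrecPred.not (primrecPred_ptHit
      (hf.comp₂ (Primrec.fst.comp .fst).to₂ .right) .snd)) hc)

theorem primrec_ptValue {f : α → ℕ → ℕ} {h n : α → ℕ} (hf : Primrec₂ f) (hh : Primrec h)
    (hn : Primrec n) : Primrec fun a => ptValue (f a) (h a) (n a) := by
  classical
  have hfirst : PrimrecRel fun a c => PtFirst (f a) c :=
    primrecPred_ptFirst (hf.comp₂ (Primrec.fst.comp .fst).to₂ .right) .snd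
  have hg := Primrec.nat_findGreatest hh hfirst
  exact Primrec.ite (primrecPred_exists_lt hfirst (Primrec.succ.comp hh))
    (Primrec.succ.comp (primrec_oneTail (Primrec.succ.comp (primrec_ptFst.comp hg))
      (primrec_ptSnd.comp hg) hn)) (.const 0)

theorem primrecPred_zeroAt {f : α → ℕ → ℕ} {i t : α → ℕ} (hf : Primrec₂ f) (hi : Primrec i)
    (ht : Primrec t) : PrimrecPred fun a => ZeroAt (f a) (i a) (t a) :=
  PrimrecPred.and
    (primrecPred_accepts hf (primrec_staged_infTest (Primrec.succ.comp hi)) ht)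
    (PrimrecPred.not (primrecPred_accepts hf (primrec_staged_limTest hi) ht))

theorem primrecPred_oneAt {f : α → ℕ → ℕ} {i t : α → ℕ} (hf : Primrec₂ f) (hi : Primrec i)
    (ht : Primrec t) : PrimrecPred fun a => OneAt (f a) (i a) (t a) :=
  PrimrecPred.and (primrecPred_accepts hf (primrec_staged_limTest hi) ht)
    (primrecPred_forall_lt (R := fun a u => ¬ ZeroAt (f a) (i a) u)
      (PrimrecPred.not (primrecPred_zeroAt
        (hf.comp₂ (Primrec.fst.comp .fst).to₂ .right) (hi.comp .fst) .snd)) ht)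

theorem primrecPred_forall_zeroAt {f : α → ℕ → ℕ} {h n : α → ℕ} (hf : Primrec₂ f)
    (hh : Primrec h) (hn : Primrec n) :
    PrimrecPred fun a => ∀ i < n a, ∃ t < h a, ZeroAt (f a) i t := by
  refine primrecPred_forall_lt (R := fun a i => ∃ t < h a, ZeroAt (f a) i t) ?_ hn
  refine primrecPred_exists_lt (R := fun (q : α × ℕ) t => ZeroAt (f q.1) q.2 t) ?_ (hh.comp .fst)
  exact primrecPred_zeroAt (hf.comp₂ (Primrec.fst.comp (Primrec.fst.comp .fst)).to₂ .right)
    (Primrec.snd.comp .fst) .snd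

theorem primrec_limValue {f : α → ℕ → ℕ} {h n : α → ℕ} (hf : Primrec₂ f) (hh : Primrec h)
    (hn : Primrec n) : Primrec fun a => limValue (f a) (h a) (n a) := by
  classical
  refine Primrec.ite (primrecPred_forall_zeroAt hf hh hn) (.const 1)
    (Primrec.ite (primrecPred_exists_lt (R := fun a j => (∃ t < h a, OneAt (f a) j t) ∧
      ∀ i < j, ∃ t < h a, ZeroAt (f a) i t) (PrimrecPred.and ?_ ?_) hn) (.const 2) (.const 0))
  · refine primrecPred_exists_lt (R := fun (q : α × ℕ) t => OneAt (f q.1) q.2 t) ?_ (hh.comp .fst)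
    exact primrecPred_oneAt (hf.comp₂ (Primrec.fst.comp (Primrec.fst.comp .fst)).to₂ .right)
      (Primrec.snd.comp .fst) .snd
  · exact primrecPred_forall_zeroAt (hf.comp₂ (Primrec.fst.comp .fst).to₂ .right)
      (hh.comp .fst) .snd

end Primrec

/-! #### The reduction -/

open Classical in
/-- The sequence that has a zero if and only if an isolated point is seen to lie in the set named
by `P`. -/
noncomputable def ptSearch (P : Baire) : Baire := fun c => if PtHit P c then 0 else 1

theorem computableFun_ptSearch : ComputableFun (ptSearch : Baire →. Baire) := by
  classical
  refine computableFun_coe (fun P P' n h => ?_) ?_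
  · exact if_congr (ptHit_congr fun i hi => h i (by omega)) rfl rfl
  · exact Primrec.ite (primrecPred_ptHit
      (primrec_ext.comp₂ (Primrec.fst.comp .fst).to₂ .right) .snd) (.const 0) (.const 1)

/-- The entries of `x` at even positions, that is, the first component of a pair. -/
def evens (x : Baire) : Baire := fun i => x (2 * i)

theorem evens_pair (p q : Baire) : evens (pair p q) = p := by
  funext i
  simp [evens, pair]

/-- The stages of the computation of an element of an overt set from a name of the set and the
answer to the question whether it has an isolated point. -/
noncomputable def chooseStage (x : Baire) (s n : ℕ) : ℕ :=
  if s < 2 then 0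
  else if x 1 = 0 then limValue (evens x) (s / 2) n else ptValue (evens x) (s / 2) n

/-- The answer of LPO sits at position 1 of the pair, hence the wait for two entries; `s` entries of
the pair contain the first `s / 2` entries of the set's name. -/
theorem isLocal_chooseStage : IsLocal chooseStage := fun x x' s n h => by
  have he : ∀ i < s / 2, evens x i = evens x' i := fun i hi => h _ (by omega)
  unfold chooseStage
  by_cases hs : s < 2
  · rw [if_pos hs, if_pos hs]
  · rw [if_neg hs, if_neg hs, h 1 (by omega), limValue_congr he, ptValue_congr he]

theorem computable_assoc_chooseStage : Computable (assoc chooseStage) := by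
  have hlen : Primrec fun q : Unit × (ℕ × List ℕ) => q.2.2.length :=
    Primrec.list_length.comp (Primrec.snd.comp .snd)
  have hhalf : Primrec fun q : Unit × (ℕ × List ℕ) => q.2.2.length / 2 :=
    Primrec.nat_div.comp hlen (.const 2)
  have hev : Primrec₂ fun (q : Unit × (ℕ × List ℕ)) => evens (ext q.2.2) :=
    primrec_ext.comp₂ (Primrec.snd.comp (Primrec.snd.comp .fst)).to₂
      (Primrec.nat_mul.comp (.const 2) .snd).to₂
  have hn : Primrec fun q : Unit × (ℕ × List ℕ) => q.2.1 := Primrec.fst.comp .snd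
  have h : Primrec₂ fun _ : Unit => assoc chooseStage := primrec_assoc <|
    Primrec.ite (Primrec.nat_lt.comp hlen (.const 2)) (.const 0) <|
      Primrec.ite (Primrec.eq.comp (primrec_ext.comp (Primrec.snd.comp .snd) (.const 1)) (.const 0))
        (primrec_limValue hev hhalf hn) (primrec_ptValue hev hhalf hn)
  exact (h.comp (.const ()) .id).to_comp

theorem VC_le_LPO : WeihrauchLE (VC Smin) LPO := by
  classical
  refine ⟨_, _, computableFun_ptSearch, computableFun_kleene computable_assoc_chooseStage,
    fun G hG P A hP hne => ?_⟩
  obtain ⟨b, hb, i, hbi, hi⟩ := hG (ptSearch P) (ptSearch P) rfl ⟨_, rfl⟩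
  have hsearch : (∃ k, ptSearch P k = 0) ↔ ∃ k, PtHit P k :=
    exists_congr fun k => by simp [ptSearch]
  have hx1 : pair P b 1 = ((if ∃ k, PtHit P k then 1 else 0 : Fin 2) : ℕ) := by
    have hi' : i = (if ∃ k, ptSearch P k = 0 then 1 else 0 : Fin 2) := hi
    have hb0 : pair P b 1 = b 0 := by simp [pair]
    subst hi'
    rw [hb0, ← if_congr hsearch rfl rfl]
    exact hbi
  suffices h : ∃ y x, SminNames y x ∧ x ∈ A.1 ∧ y ∈ kleene (assoc chooseStage) (pair P b) by
    obtain ⟨y, x, hyx, hx, hy⟩ := h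
    refine ⟨y, ?_, x, hyx, hx⟩
    simp only [Part.mem_bind_iff]
    exact ⟨_, by simp, b, hb, hy⟩
  by_cases hex : ∃ k, PtHit P k
  · have h1 : pair P b 1 ≠ 0 := by
      rw [hx1, if_pos hex]
      simp
    have hfirst : PtFirst P (Nat.find hex) :=
      ⟨Nat.find_spec hex, fun j hj => Nat.find_min hex hj⟩
    refine ⟨_, .pt _ _, rfl, hfirst.1.mem hP, mem_kleene_assoc isLocal_chooseStage
      -- Half of this stage reaches the first hit, and it is at least 2, so the answer of LPO has
      -- been read.
      (fun n => ⟨2 * Nat.find hex + 2, ?_⟩) fun n s => ?_⟩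
    · rw [chooseStage, if_neg (by omega), if_neg h1, evens_pair, hfirst.ptValue, if_pos (by omega)]
      simp
    · rw [chooseStage, if_neg h1, evens_pair, hfirst.ptValue]
      split_ifs <;> simp
  · have h1 : pair P b 1 = 0 := by
      rw [hx1, if_neg hex]
      simp
    obtain ⟨y, x, hyx, hx, hy⟩ := exists_limValue hP hne fun a b hab =>
      hex ((exists_ptHit_iff hP).2 ⟨a, b, hab⟩)
    refine ⟨y, x, hyx, hx, mem_kleene_assoc isLocal_chooseStage (fun n => ?_) fun n s => ?_⟩
    · obtain ⟨h, hh⟩ := (hy n).1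
      refine ⟨2 * h + 2, ?_⟩
      rw [chooseStage, if_neg (by omega), if_pos h1, evens_pair]
      exact hh _ (by omega)
    · rw [chooseStage, if_pos h1, evens_pair]
      split_ifs
      · simp
      · exact (hy n).2 _

end OvertChoice

theorem mainTheorem10 :
    OvertChoice.WeihrauchEquiv (OvertChoice.VC OvertChoice.Smin) OvertChoice.LPO :=
  ⟨OvertChoice.VC_le_LPO, OvertChoice.LPO_le_VC⟩
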